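/- **Setting.** Let $\Omega\subset\mathbb R^3$ be a bounded polyhedral open set with $\Omega=\operatorname{int}\overline\Omega$ (for instance a Lipschitz polyhedral domain), and let $\mathcal T_h$ be a face-to-face triangulation of $\overline\Omega$ into finitely many closed nondegenerate tetrahedra; $h_T$ is the diameter of $T$. Let $\mathcal F_h^\partial$ be the set of facets contained in $\partial\Omega$ and $\mathcal F_h^\circ$ the set of the other (interior) facets. The two elements sharing an interior facet are labelled $T^+,T^-$ arbitrarily, and $\boldsymbol n^+$ is the unit normal outward from $T^+$; on a boundary facet $T^+$ is its element and $\boldsymbol n^+=\boldsymbol n$ is the outward normal of $\Omega$. Put $[\![\boldsymbol v]\!]=\boldsymbol v^+-\boldsymbol v^-$ on interior facets and $[\![\boldsymbol v]\!]=\boldsymbol v$ on boundary facets. Let $\boldsymbol V_h$ be an $\boldsymbol H(\mathrm{curl};\Omega)$-conforming space of vector fields that are polynomial (of degree at most some $r$) on each $T$, and $\boldsymbol V_h|_T$ the space of restrictions to $T$. Let $\varepsilon>0$ be constant, $\boldsymbol\beta\in W^{1,\infty}(\Omega)^3$ (its representative continuous on $\overline\Omega$), $\gamma\in L^\infty(\Omega)$,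 and suppose that for some constant $\rho_0>0$ $$\lambda_{\min}\Big[\big(\gamma-\tfrac{\nabla\cdot\boldsymbol\beta}{2}\big)I+\tfrac{\nabla\boldsymbol\beta+(\nabla\boldsymbol\beta)^T}{2}\Big]\ge\rho_0\quad\text{a.e. in }\Omega.$$ Let the weight $\alpha$ take on each interior facet two bounded measurable values $\alpha^\pm$, belonging to $T^\pm$, with $\alpha^++\alpha^-=1$; put $[\alpha]=\alpha^+-\alpha^-$. On $\partial\Omega$ put $\alpha=0$ where $\boldsymbol\beta\cdot\boldsymbol n\ge0$ and $\alpha=1$ where $\boldsymbol\beta\cdot\boldsymbol n<0$. Suppose that for some constant $C_{up}>0$ $$-\boldsymbol\beta\cdot\boldsymbol n^+\,(\alpha^+-\alpha^-)\ge C_{up}|\boldsymbol\beta\cdot\boldsymbol n^+|\quad\text{on all interior facets.}$$ For $\boldsymbol g$ on the facets, let $\boldsymbol r_\alpha(\boldsymbol g)|_T\in\boldsymbol V_h|_T$ be the lifting: $\int_T\boldsymbol r_\alpha(\boldsymbol g)\cdot\boldsymbol w=\int_{\partial T}\alpha|_{\partial T}\,\boldsymbol g\cdot\boldsymbol w$ for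 all $\boldsymbol w\in\boldsymbol V_h|_T$. On each $T$ let $L_{\boldsymbol\beta}\boldsymbol u=-\boldsymbol\beta\times(\nabla\times\boldsymbol u)+\nabla(\boldsymbol\beta\cdot\boldsymbol u)$, $\tilde L_{\boldsymbol\beta,h}\boldsymbol u=L_{\boldsymbol\beta}\boldsymbol u-\boldsymbol r_\alpha(\boldsymbol\beta\cdot\boldsymbol n^+[\![\boldsymbol u]\!])|_T$ and $\tilde{\mathcal A}_h\boldsymbol u=\nabla\times(\varepsilon\nabla\times\boldsymbol u)+\tilde L_{\boldsymbol\beta,h}\boldsymbol u+\gamma\boldsymbol u$. With constants $\delta_T\ge0$ define $$a_h(\boldsymbol u,\boldsymbol v)=(\varepsilon\nabla\times\boldsymbol u,\nabla\times\boldsymbol v)+(\tilde L_{\boldsymbol\beta,h}\boldsymbol u+\gamma\boldsymbol u,\boldsymbol v)+\sum_{T\in\mathcal T_h}(\tilde{\mathcal A}_h\boldsymbol u,\delta_T\tilde L_{\boldsymbol\beta,h}\boldsymbol v)_T,$$ $$|||\boldsymbol u|||^2=\varepsilon\|\nabla\times\boldsymbol u\|_0^2+\rho_0\|\boldsymbol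 u\|_0^2+\sum_{T}\delta_T\|\tilde L_{\boldsymbol\beta,h}\boldsymbol u\|_{0,T}^2+\frac12\sum_{F\in\mathcal F_h^\circ}\int_F\big|[\alpha]\boldsymbol\beta\cdot\boldsymbol n^+\big|\,\big|[\![\boldsymbol u]\!]\big|^2+\frac12\sum_{F\in\mathcal F_h^\partial}\int_F|\boldsymbol\beta\cdot\boldsymbol n|\,|\boldsymbol u|^2 .$$ Let $C_{inv}>0$ be a constant in the inverse inequality $$\|\nabla\times(\nabla\times\boldsymbol v_h)\|_{0,T}\le C_{inv}h_T^{-1}\|\nabla\times\boldsymbol v_h\|_{0,T}\qquad\forall\,\boldsymbol v_h\in\boldsymbol V_h,\ T\in\mathcal T_h. \tag{1}$$ **Lemma 4.2 (discrete coercivity).** A constant $C_{inv}$ with (1) exists and can be chosen to depend only on the shape-regularity constant of $\mathcal T_h$ and on the degree bound $r$. For every $C_{inv}>0$ with (1): if $$\delta_T\le\min\Big\{\frac{h_T^2}{2C_{inv}^2\varepsilon},\ \frac{\rho_0}{2\|\gamma\|_{L^\infty(T)}^2}\Big\}\qquad\forall\,T\in\mathcal T_h$$ (the second bound being void where $\gamma=0$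 a.e. on $T$), then $$a_h(\boldsymbol v_h,\boldsymbol v_h)\ge\tfrac12|||\boldsymbol v_h|||^2\qquad\forall\,\boldsymbol v_h\in\boldsymbol V_h .$$ -/

import Mathlib

open MeasureTheory Set
open scoped ContDiff InnerProductSpace ENNReal

noncomputable section

namespace SUPG

/-- Three-dimensional Euclidean space. -/
abbrev R3 : Type := EuclideanSpace ℝ (Fin 3)

/-- The vector product of `ℝ³`. -/
def cross (a b : R3) : R3 := WithLp.toLp 2 (crossProduct a.ofLp b.ofLp)

/-! ### Weak derivatives -/

/-- `G` is the weak gradient of the scalar function `f` on the open set `U`. -/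
structure IsWeakGrad (U : Set R3) (f : R3 → ℝ) (G : R3 → R3) : Prop where
  locInt : LocallyIntegrableOn G U volume
  byParts : ∀ φ : R3 → ℝ, ContDiff ℝ ∞ φ → HasCompactSupport φ → tsupport φ ⊆ U →
    ∫ x in U, f x • gradient φ x = - ∫ x in U, φ x • G x

open Classical in
/-- The weak gradient of `f` on `U` (unique up to null sets; `0` if there is none). -/
def weakGrad (U : Set R3) (f : R3 → ℝ) : R3 → R3 :=
  if h : ∃ G, IsWeakGrad U f G then h.choose else 0

/-- The Sobolev space `W^{1,∞}(U)`. -/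
def MemW1inf (U : Set R3) (f : R3 → ℝ) : Prop :=
  MemLp f ∞ (volume.restrict U) ∧
    ∃ G, IsWeakGrad U f G ∧ MemLp G ∞ (volume.restrict U)

/-- The classical partial derivative `∂ᵢ φⱼ`. -/
def pd (φ : R3 → R3) (i j : Fin 3) (x : R3) : ℝ :=
  (fderiv ℝ φ x (EuclideanSpace.single i 1)) j

/-- The classical curl. -/
def classicalCurl (φ : R3 → R3) (x : R3) : R3 :=
  WithLp.toLp 2 ![pd φ 1 2 x - pd φ 2 1 x, pd φ 2 0 x - pd φ 0 2 x, pd φ 0 1 x - pd φ 1 0 x]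

/-- `w` is the weak curl of `v` on `U`. -/
def IsWeakCurl (U : Set R3) (v w : R3 → R3) : Prop :=
  ∀ φ : R3 → R3, ContDiff ℝ ∞ φ → HasCompactSupport φ → tsupport φ ⊆ U →
    ∫ x in U, ⟪v x, classicalCurl φ x⟫_ℝ = ∫ x in U, ⟪w x, φ x⟫_ℝ

/-- The space `H(curl; U)`. -/
def MemHcurl (U : Set R3) (v : R3 → R3) : Prop :=
  MemLp v 2 (volume.restrict U) ∧
    ∃ w, MemLp w 2 (volume.restrict U) ∧ IsWeakCurl U v w

/-! ### Polynomial vector fields -/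

/-- Polynomial vector fields on `ℝ³`. -/
abbrev PolyField : Type := Fin 3 → MvPolynomial (Fin 3) ℝ

/-- The vector field `ℝ³ → ℝ³` given by a triple of polynomials. -/
def ev (p : PolyField) (x : R3) : R3 :=
  WithLp.toLp 2 fun i => MvPolynomial.eval (fun j => x j) (p i)

/-- The curl of a polynomial vector field. -/
def curl (p : PolyField) : PolyField :=
  ![MvPolynomial.pderiv 1 (p 2) - MvPolynomial.pderiv 2 (p 1),
    MvPolynomial.pderiv 2 (p 0) - MvPolynomial.pderiv 0 (p 2),
    MvPolynomial.pderiv 0 (p 1) - MvPolynomial.pderiv 1 (p 0)]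

/-! ### Triangulations -/

/-- The closed simplex with the given vertices. -/
def hull (s : Finset R3) : Set R3 := convexHull ℝ (s : Set R3)

/-- A (face-to-face) triangulation of `Ω` by finitely many nondegenerate closed tetrahedra; a
tetrahedron is given by its set of vertices. -/
structure Triangulation (Ω : Set R3) where
  elements : Finset (Finset R3)
  card_eq : ∀ T ∈ elements, T.card = 4
  indep : ∀ T ∈ elements, AffineIndependent ℝ ((↑) : T → R3)
  inter : ∀ T ∈ elements, ∀ T' ∈ elements,
    hull T ∩ hull T' = convexHull ℝ ((T : Set R3) ∩ (T' : Set R3))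
  cover : ⋃ T ∈ elements, hull T = closure Ω

namespace Triangulation

variable {Ω : Set R3}

/-- The elements of the triangulation. -/
abbrev Elem (M : Triangulation Ω) : Type := {T : Finset R3 // T ∈ M.elements}

open Classical in
/-- The facets (triangles) of the elements, given by their sets of vertices. -/
def facets (M : Triangulation Ω) : Finset (Finset R3) :=
  M.elements.biUnion fun T => T.powersetCard 3

/-- The facets of the triangulation. -/
abbrev Facet (M : Triangulation Ω) : Type := {F : Finset R3 // F ∈ M.facets}

/-- A boundary facet is one that lies in `∂Ω`. -/
def IsBoundary (M : Triangulation Ω) (F : M.Facet) : Prop := hull F.1 ⊆ frontier Ω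

/-- The interior facets are the other ones. -/
def IsInterior (M : Triangulation Ω) (F : M.Facet) : Prop := ¬ M.IsBoundary F

/-- The diameter of an element. -/
def diam (M : Triangulation Ω) (T : M.Elem) : ℝ := Metric.diam (hull T.1)

/-- Shape regularity with constant `σ`: every element `T` contains a ball whose diameter is at
least `h_T / σ`. -/
def ShapeRegular (M : Triangulation Ω) (σ : ℝ) : Prop :=
  ∀ T : M.Elem, ∃ (c : R3) (ρ : ℝ), 0 < ρ ∧ Metric.ball c ρ ⊆ hull T.1 ∧ M.diam T ≤ σ * (2 * ρ)

/-- A labelling of the neighbours of the facets: an interior facet is shared by two elements `T⁺`,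
`T⁻`; on a boundary facet, `T⁺` is the element that has this facet (and `minus` is not used). -/
structure Labelling (M : Triangulation Ω) where
  plus : M.Facet → M.Elem
  minus : M.Facet → M.Elem
  subset_plus : ∀ F, F.1 ⊆ (plus F).1
  subset_minus : ∀ F, M.IsInterior F → F.1 ⊆ (minus F).1
  ne : ∀ F, M.IsInterior F → plus F ≠ minus F

end Triangulation

/-- The surface measure on a facet (two-dimensional Hausdorff measure, normalized to be the area
on planes). -/
def surface (F : Finset R3) : Measure R3 :=
  (Measure.euclideanHausdorffMeasure 2 : Measure R3).restrict (hull F)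

open Classical in
/-- The unit normal of the facet `F` of the tetrahedron `T` that points out of `T`. -/
def outwardNormal (T F : Finset R3) : R3 :=
  if h : ∃ n : R3, ‖n‖ = 1 ∧ (∀ x ∈ F, ∀ y ∈ F, ⟪n, x - y⟫_ℝ = 0) ∧
      ∀ x ∈ F, ∀ y ∈ T, y ∉ F → ⟪n, y - x⟫_ℝ < 0
  then h.choose else 0

/-! ### Finite element spaces -/

variable {Ω : Set R3}

/-- Piecewise polynomial vector fields on the triangulation, one polynomial field per element. -/
abbrev Broken (M : Triangulation Ω) : Type := M.Elem → PolyField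

open Classical in
/-- A piecewise polynomial field as a function on `ℝ³` (the value on the null set of the element
boundaries is irrelevant). -/
def Broken.toFun {M : Triangulation Ω} (v : Broken M) (x : R3) : R3 :=
  ∑ T : M.Elem, if x ∈ interior (hull T.1) then ev (v T) x else 0

/-- `V` is an `H(curl; Ω)`-conforming finite element space of degree at most `r`. -/
structure IsCurlConforming (M : Triangulation Ω) (V : Submodule ℝ (Broken M)) (r : ℕ) : Prop where
  degree_le : ∀ v ∈ V, ∀ T i, (v T i).totalDegree ≤ r
  conforming : ∀ v ∈ V, MemHcurl Ω (Broken.toFun v)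

/-- The space `V|_T` of the restrictions of the functions in `V` to the element `T`. -/
def localSpace {M : Triangulation Ω} (V : Submodule ℝ (Broken M)) (T : M.Elem) :
    Submodule ℝ PolyField :=
  V.map (LinearMap.proj T)

/-- The `L²(T)` norm. -/
def l2norm (T : Finset R3) (w : R3 → R3) : ℝ := Real.sqrt (∫ x in hull T, ‖w x‖ ^ 2)

/-- `C` is a constant in the inverse inequality for the curl operator on `V`. -/
def InverseCurl (M : Triangulation Ω) (V : Submodule ℝ (Broken M)) (C : ℝ) : Prop :=
  ∀ v ∈ V, ∀ T : M.Elem,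
    l2norm T.1 (ev (curl (curl (v T)))) ≤ C * (M.diam T)⁻¹ * l2norm T.1 (ev (curl (v T)))

/-! ### The data -/

/-- The matrix `(γ - (∇·β)/2) I + (∇β + (∇β)ᵀ)/2`. -/
def friedrichsMatrix (Ω : Set R3) (β : R3 → R3) (γ : R3 → ℝ) (x : R3) : Matrix (Fin 3) (Fin 3) ℝ :=
  let D : Matrix (Fin 3) (Fin 3) ℝ := Matrix.of fun i j => weakGrad Ω (fun y => β y j) x i
  (γ x - D.trace / 2) • (1 : Matrix (Fin 3) (Fin 3) ℝ) + (1 / 2 : ℝ) • (D + D.transpose)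

theorem friedrichsMatrix_isHermitian (Ω : Set R3) (β : R3 → R3) (γ : R3 → ℝ) (x : R3) :
    (friedrichsMatrix Ω β γ x).IsHermitian := by
  ext i j
  simp only [friedrichsMatrix, Matrix.conjTranspose_apply, Matrix.add_apply, Matrix.smul_apply,
    Matrix.transpose_apply, star_trivial, Matrix.one_apply, eq_comm (a := i) (b := j), add_comm]

/-- The smallest eigenvalue of a real symmetric `3 × 3` matrix. -/
def lambdaMin {A : Matrix (Fin 3) (Fin 3) ℝ} (hA : A.IsHermitian) : ℝ := ⨅ i, hA.eigenvalues i

/-- The Friedrichs positivity condition with constant `ρ₀`. -/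
def Friedrichs (Ω : Set R3) (β : R3 → R3) (γ : R3 → ℝ) (ρ₀ : ℝ) : Prop :=
  ∀ᵐ x ∂(volume.restrict Ω), ρ₀ ≤ lambdaMin (friedrichsMatrix_isHermitian Ω β γ x)

/-- The velocity field is in `W^{1,∞}(Ω)³` and is given by its representative that is continuous up
to the boundary. -/
structure IsVelocity (Ω : Set R3) (β : R3 → R3) : Prop where
  cont : ContinuousOn β (closure Ω)
  sobolev : ∀ j, MemW1inf Ω fun x => β x j

/-- The unit normal `n⁺` of a facet: outward with respect to `T⁺`. On a boundary facet this is the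
unit outward normal of `Ω`. -/
def Triangulation.Labelling.normal {M : Triangulation Ω} (o : M.Labelling) (F : M.Facet) : R3 :=
  outwardNormal (o.plus F).1 F.1

/-- A facet weight on the interior facets: bounded functions `α⁺`, `α⁻` with `α⁺ + α⁻ = 1`. -/
structure IsFacetWeight (M : Triangulation Ω) (αp αm : M.Facet → R3 → ℝ) : Prop where
  memLp_plus : ∀ F, M.IsInterior F → MemLp (αp F) ∞ (surface F.1)
  memLp_minus : ∀ F, M.IsInterior F → MemLp (αm F) ∞ (surface F.1)
  add_eq_one : ∀ F, M.IsInterior F → ∀ x ∈ hull F.1, αp F x + αm F x = 1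

/-- The upwind condition `-β·n⁺ (α⁺ - α⁻) ≥ C |β·n|` on the interior facets. -/
def Upwind {M : Triangulation Ω} (o : M.Labelling) (β : R3 → R3) (αp αm : M.Facet → R3 → ℝ)
    (C : ℝ) : Prop :=
  ∀ F, M.IsInterior F → ∀ x ∈ hull F.1,
    -⟪β x, o.normal F⟫_ℝ * (αp F x - αm F x) ≥ C * |⟪β x, o.normal F⟫_ℝ|

open Classical in
/-- The restriction of the weight to the facet `F` of `∂T`: the value `α^±` for `T = T^±` if `F` is
interior; on the boundary, `0` where `β·n ≥ 0` and `1` where `β·n < 0`. -/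
def weight {M : Triangulation Ω} (o : M.Labelling) (β : R3 → R3) (αp αm : M.Facet → R3 → ℝ)
    (T : M.Elem) (F : M.Facet) (x : R3) : ℝ :=
  if M.IsInterior F then (if T = o.plus F then αp F x else αm F x)
  else if ⟪β x, o.normal F⟫_ℝ < 0 then 1 else 0

open Classical in
/-- The jump `u⁺ - u⁻` on an interior facet, and the trace of `u` on a boundary facet. -/
def jump {M : Triangulation Ω} (o : M.Labelling) (u : Broken M) (F : M.Facet) (x : R3) : R3 :=
  if M.IsInterior F then ev (u (o.plus F)) x - ev (u (o.minus F)) x else ev (u (o.plus F)) x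

open Classical in
/-- `r ∈ V|_T` satisfies `∫_T r·w = ∫_{∂T} α g·w` for all `w ∈ V|_T`. -/
def IsLifting {M : Triangulation Ω} (V : Submodule ℝ (Broken M)) (o : M.Labelling) (β : R3 → R3)
    (αp αm : M.Facet → R3 → ℝ) (g : M.Facet → R3 → R3) (T : M.Elem) (r : PolyField) : Prop :=
  r ∈ localSpace V T ∧ ∀ w ∈ localSpace V T,
    ∫ x in hull T.1, ⟪ev r x, ev w x⟫_ℝ =
      ∑ F : M.Facet with F.1 ⊆ T.1, ∫ x, weight o β αp αm T F x * ⟪g F x, ev w x⟫_ℝ ∂(surface F.1)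

open Classical in
/-- The lifting `r_α|_T (g)`. -/
def lifting {M : Triangulation Ω} (V : Submodule ℝ (Broken M)) (o : M.Labelling) (β : R3 → R3)
    (αp αm : M.Facet → R3 → ℝ) (g : M.Facet → R3 → R3) (T : M.Elem) : PolyField :=
  if h : ∃ r, IsLifting V o β αp αm g T r then h.choose else 0

/-- The magnetic advection `L_β p = -β × (∇ × p) + ∇(β·p)` on the element `T`. -/
def lieAdv (β : R3 → R3) (T : Finset R3) (p : PolyField) (x : R3) : R3 :=
  -cross (β x) (ev (curl p) x) + weakGrad (interior (hull T)) (fun y => ⟪β y, ev p y⟫_ℝ) x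

/-- The discrete magnetic advection `L_{β,h} u - r_α(β·n⁺ ⟦u⟧)` on the element `T`. -/
def discAdv {M : Triangulation Ω} (V : Submodule ℝ (Broken M)) (o : M.Labelling) (β : R3 → R3)
    (αp αm : M.Facet → R3 → ℝ) (u : Broken M) (T : M.Elem) (x : R3) : R3 :=
  lieAdv β T.1 (u T) x
    - ev (lifting V o β αp αm (fun F y => ⟪β y, o.normal F⟫_ℝ • jump o u F y) T) x

/-- The modified advection-diffusion-reaction operator on the element `T`. -/
def modOp {M : Triangulation Ω} (V : Submodule ℝ (Broken M)) (o : M.Labelling) (ε : ℝ)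
    (β : R3 → R3) (γ : R3 → ℝ) (αp αm : M.Facet → R3 → ℝ) (u : Broken M) (T : M.Elem)
    (x : R3) : R3 :=
  ε • ev (curl (curl (u T))) x + discAdv V o β αp αm u T x + γ x • ev (u T) x

/-- The SUPG bilinear form `a_h`; the `L²(Ω)` products are written as sums over the elements. -/
def supgForm {M : Triangulation Ω} (V : Submodule ℝ (Broken M)) (o : M.Labelling) (ε : ℝ)
    (β : R3 → R3) (γ : R3 → ℝ) (αp αm : M.Facet → R3 → ℝ) (δ : M.Elem → ℝ)
    (u v : Broken M) : ℝ :=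
  (∑ T : M.Elem, ∫ x in hull T.1, ⟪ε • ev (curl (u T)) x, ev (curl (v T)) x⟫_ℝ)
  + (∑ T : M.Elem, ∫ x in hull T.1,
      ⟪discAdv V o β αp αm u T x + γ x • ev (u T) x, ev (v T) x⟫_ℝ)
  + ∑ T : M.Elem, ∫ x in hull T.1,
      ⟪modOp V o ε β γ αp αm u T x, δ T • discAdv V o β αp αm v T x⟫_ℝ

open Classical in
/-- The square of the energy norm. -/
def energySq {M : Triangulation Ω} (V : Submodule ℝ (Broken M)) (o : M.Labelling) (ε ρ₀ : ℝ)
    (β : R3 → R3) (αp αm : M.Facet → R3 → ℝ) (δ : M.Elem → ℝ) (u : Broken M) : ℝ :=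
  ε * (∑ T : M.Elem, l2norm T.1 (ev (curl (u T))) ^ 2)
  + ρ₀ * (∑ T : M.Elem, l2norm T.1 (ev (u T)) ^ 2)
  + (∑ T : M.Elem, δ T * l2norm T.1 (discAdv V o β αp αm u T) ^ 2)
  + 1 / 2 * (∑ F : M.Facet with M.IsInterior F,
      ∫ x, |(αp F x - αm F x) * ⟪β x, o.normal F⟫_ℝ| * ‖jump o u F x‖ ^ 2 ∂(surface F.1))
  + 1 / 2 * (∑ F : M.Facet with M.IsBoundary F,
      ∫ x, |⟪β x, o.normal F⟫_ℝ| * ‖jump o u F x‖ ^ 2 ∂(surface F.1))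

/-- The `L^∞(T)` norm. -/
def linftyNorm (T : Finset R3) (f : R3 → ℝ) : ℝ :=
  (eLpNorm f ∞ (volume.restrict (hull T))).toReal

end SUPG

end

open SUPG

/-!
**Inverse inequality.** A shape-regular element `T` contains a ball `B(c, ρ)` and lies in the
concentric ball of radius `2σρ`. After the substitution `x ↦ c + ρ x`, which keeps the polynomial
degree, the claim is that on the finite-dimensional space of polynomial fields of degree at most `r`
a seminorm is bounded by a multiple of a norm, here the `L²` norm on the unit ball
(`exists_inverse_inequality`).

**Coercivity.** Pointwise, for a polynomial field `p`, the quadratic form `⟪L_β p + γ p, p⟫` is the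
quadratic form of the Friedrichs matrix plus `½ ∇·(|p|² β)` (`inner_advection_eq`). The divergence
theorem turns the second part into a sum over the facets of the element. Subtracting the lifting
and collecting the terms by facets, an interior facet, which belongs to exactly two elements with
opposite normals, contributes
`½ β·n (|u⁺|² - |u⁻|²) - β·n (u⁺ - u⁻)·(α⁺ u⁺ + α⁻ u⁻) = -½ [α] β·n |u⁺ - u⁻|²`,
which is nonnegative by the upwind condition (`facetTerm_interior`); a boundary facet, which belongs
to a single element since `Ω` is the interior of its closure, contributes `½ |β·n| |u|²`
(`facetTerm_boundary`). In the stabilization term, Young's inequality, the inverse inequality and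
the bounds on `δ_T` absorb the second-order and the reaction term (`integral_modOp_ge`,
`delta_mul_curl_curl_le`).

**The divergence theorem** is needed for `f = |p|² β_j`, which is continuous on the closed element
and has a bounded weak gradient `G` inside (`integral_weakGrad_simplex`). With barycentric
coordinates `λ_a` and a smooth step function `η`, the function `φ_k = ∏ₐ η(k λ_a)` is a test
function for the weak gradient, and `φ_k → 1` inside the element, so that `∫ φ_k G → ∫ G`. The
gradient of `φ_k` lives on layers of width `O(1/k)` along the facets. In orthonormal coordinates adapted to a
facet, with the normal coordinate scaled by `k`, dominated convergence shows that `∫ f ∇φ_k` tends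
to minus the sum of the integrals of `f n` over the facets (`tendsto_integral_layer`).
-/

namespace SUPG

/-! ### Polynomial fields -/

/-- The real function on `ℝ³` given by a polynomial. -/
noncomputable def evs (p : MvPolynomial (Fin 3) ℝ) (x : R3) : ℝ :=
  MvPolynomial.eval (fun j => x j) p

/-- The gradient of a polynomial, as a polynomial field. -/
noncomputable def polyGrad (p : MvPolynomial (Fin 3) ℝ) : PolyField :=
  fun i => MvPolynomial.pderiv i p

theorem ev_apply (p : PolyField) (x : R3) (i : Fin 3) : ev p x i = evs (p i) x := rfl

theorem evs_add (p q : MvPolynomial (Fin 3) ℝ) (x : R3) : evs (p + q) x = evs p x + evs q x := by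
  simp [evs]

theorem evs_sub (p q : MvPolynomial (Fin 3) ℝ) (x : R3) : evs (p - q) x = evs p x - evs q x := by
  simp [evs]

theorem evs_mul (p q : MvPolynomial (Fin 3) ℝ) (x : R3) : evs (p * q) x = evs p x * evs q x := by
  simp [evs]

theorem ev_add (p q : PolyField) (x : R3) : ev (p + q) x = ev p x + ev q x := by
  ext i; simp [ev]

theorem ev_smul (c : ℝ) (p : PolyField) (x : R3) : ev (c • p) x = c • ev p x := by
  ext i; simp [ev, MvPolynomial.smul_eval]

theorem hasGradientAt_evs (p : MvPolynomial (Fin 3) ℝ) (x : R3) :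
    HasGradientAt (evs p) (ev (polyGrad p) x) x := by
  induction p using MvPolynomial.induction_on with
  | C a =>
    have h1 : evs (MvPolynomial.C a) = fun _ => a := by ext y; simp [evs]
    have h2 : ev (polyGrad (MvPolynomial.C a)) x = 0 := by ext i; simp [ev, polyGrad]
    rw [h1, h2]
    exact hasGradientAt_const x a
  | add p q hp hq =>
    have h1 : evs (p + q) = evs p + evs q := by ext y; simp [evs]
    have h2 : ev (polyGrad (p + q)) x = ev (polyGrad p) x + ev (polyGrad q) x := by
      ext i; simp [ev, polyGrad]
    rw [h1, h2, hasGradientAt_iff_hasFDerivAt, map_add]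
    exact hp.hasFDerivAt.add hq.hasFDerivAt
  | mul_X p i hp =>
    have h1 : evs (p * MvPolynomial.X i) = fun y : R3 => evs p y * y i := by
      ext y; simp [evs]
    rw [h1, hasGradientAt_iff_hasFDerivAt]
    have h3 : HasFDerivAt (fun y : R3 => y i) (EuclideanSpace.proj i : R3 →L[ℝ] ℝ) x :=
      (EuclideanSpace.proj i : R3 →L[ℝ] ℝ).hasFDerivAt
    refine (hp.hasFDerivAt.mul h3).congr_fderiv ?_
    ext z
    have hx : (EuclideanSpace.proj i : R3 →L[ℝ] ℝ) z = z i := rfl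
    simp only [polyGrad, InnerProductSpace.toDual_apply_apply, add_apply, smul_apply, hx,
      PiLp.inner_apply, ev_apply, evs,
      MvPolynomial.pderiv_mul, MvPolynomial.pderiv_X, map_add, map_mul, MvPolynomial.eval_X,
      smul_eq_mul, RCLike.inner_apply, conj_trivial, Fin.sum_univ_three]
    fin_cases i <;> simp <;> ring

theorem contDiff_evs (p : MvPolynomial (Fin 3) ℝ) : ContDiff ℝ ∞ (evs p) := by
  have : AnalyticOnNhd ℝ (evs p) univ := AnalyticOnNhd.eval_continuousLinearMap
    (PiLp.continuousLinearEquiv 2 ℝ (fun _ : Fin 3 => ℝ)).toContinuousLinearMap p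
  exact contDiffOn_univ.mp (this.contDiffOn uniqueDiffOn_univ)

theorem continuous_evs (p : MvPolynomial (Fin 3) ℝ) : Continuous (evs p) :=
  (contDiff_evs p).continuous

theorem continuous_ev (p : PolyField) : Continuous (ev p) :=
  (PiLp.continuous_toLp 2 _).comp (continuous_pi fun i => continuous_evs (p i))

/-- A polynomial that vanishes on a nonempty open set is zero. -/
theorem eq_zero_of_evs_eq_zero {U : Set R3} (hU : IsOpen U) (hne : U.Nonempty)
    {p : MvPolynomial (Fin 3) ℝ} (h : ∀ x ∈ U, evs p x = 0) : p = 0 := by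
  obtain ⟨x, hx⟩ := hne
  have ho : IsOpen ((WithLp.toLp 2 : (Fin 3 → ℝ) → R3) ⁻¹' U) :=
    hU.preimage (PiLp.continuous_toLp 2 _)
  obtain ⟨ρ, hρ, hb⟩ := Metric.isOpen_iff.mp ho x.ofLp (by simpa using hx)
  rw [ball_pi _ hρ] at hb
  refine MvPolynomial.funext_set (fun i => Metric.ball (x i) ρ) (fun i => ?_) ?_
  · rw [Real.ball_eq_Ioo]; exact Ioo_infinite (by linarith)
  · intro y hy
    have := h _ (hb hy)
    simpa [evs] using this

theorem eq_zero_of_ev_eq_zero {U : Set R3} (hU : IsOpen U) (hne : U.Nonempty)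
    {p : PolyField} (h : ∀ x ∈ U, ev p x = 0) : p = 0 := by
  funext i
  refine eq_zero_of_evs_eq_zero hU hne fun x hx => ?_
  rw [← ev_apply, h x hx]; rfl

theorem eq_zero_of_integral_norm_sq_eq_zero {S : Set R3} (hS : IsCompact S)
    (hne : (interior S).Nonempty) {p : PolyField} (h : ∫ x in S, ‖ev p x‖ ^ 2 = 0) : p = 0 := by
  have hc : Continuous fun x => ‖ev p x‖ ^ 2 := ((continuous_ev p).norm).pow 2
  have h0 := (setIntegral_eq_zero_iff_of_nonneg_ae
    (Filter.Eventually.of_forall fun x => by positivity)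
    (hc.continuousOn.integrableOn_compact hS)).mp h
  have h1 : (fun x => ‖ev p x‖ ^ 2) =ᵐ[volume.restrict (interior S)] fun _ => 0 :=
    ae_restrict_of_ae_restrict_of_subset interior_subset h0
  have h2 := Measure.eqOn_open_of_ae_eq h1 isOpen_interior hc.continuousOn continuousOn_const
  exact eq_zero_of_ev_eq_zero isOpen_interior hne fun x hx => by simpa using h2 hx

/-! ### Polynomial fields of bounded degree -/

/-- The polynomial fields whose components have degree at most `r`. -/
noncomputable def polyDeg (r : ℕ) : Submodule ℝ PolyField :=
  LinearMap.range (LinearMap.pi fun i =>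
    (MvPolynomial.restrictTotalDegree (Fin 3) ℝ r).subtype ∘ₗ
      (LinearMap.proj i : (Fin 3 → MvPolynomial.restrictTotalDegree (Fin 3) ℝ r) →ₗ[ℝ] _))

instance (r : ℕ) : FiniteDimensional ℝ (polyDeg r) := by
  unfold polyDeg; infer_instance

theorem mem_polyDeg {r : ℕ} {p : PolyField} : p ∈ polyDeg r ↔ ∀ i, (p i).totalDegree ≤ r := by
  constructor
  · rintro ⟨q, rfl⟩ i
    exact (MvPolynomial.mem_restrictTotalDegree _ _ _).mp (q i).2
  · intro h
    exact ⟨fun i => ⟨p i, (MvPolynomial.mem_restrictTotalDegree _ _ _).mpr (h i)⟩, rfl⟩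

theorem totalDegree_pderiv_le (i : Fin 3) (p : MvPolynomial (Fin 3) ℝ) :
    (MvPolynomial.pderiv i p).totalDegree ≤ p.totalDegree := by
  conv_lhs => rw [p.as_sum, map_sum]
  refine MvPolynomial.totalDegree_finsetSum_le fun s hs => ?_
  rw [MvPolynomial.pderiv_monomial]
  refine (MvPolynomial.totalDegree_monomial_le _ _).trans ?_
  refine le_trans ?_ (MvPolynomial.le_totalDegree hs)
  rw [Finsupp.sum_fintype _ _ (by simp), Finsupp.sum_fintype _ _ (by simp)]
  exact Finset.sum_le_sum fun j _ => by simp [Finsupp.tsub_apply]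

theorem curl_mem_polyDeg {r : ℕ} {p : PolyField} (hp : p ∈ polyDeg r) : curl p ∈ polyDeg r := by
  rw [mem_polyDeg] at hp ⊢
  have h : ∀ i j k l, (MvPolynomial.pderiv i (p j) - MvPolynomial.pderiv k (p l)).totalDegree ≤ r :=
    fun i j k l => (MvPolynomial.totalDegree_sub _ _).trans
      (max_le ((totalDegree_pderiv_le _ _).trans (hp _)) ((totalDegree_pderiv_le _ _).trans (hp _)))
  intro i
  fin_cases i <;> simp [curl, h]

theorem curl_add (p q : PolyField) : curl (p + q) = curl p + curl q := by
  funext i; fin_cases i <;> simp [curl] <;> ring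

theorem curl_smul (c : ℝ) (p : PolyField) : curl (c • p) = c • curl p := by
  funext i; fin_cases i <;> simp [curl, smul_sub]

/-! ### The inverse inequality -/

theorem memLp_ev (p : PolyField) {S : Set R3} (hS : IsCompact S) (q : ℝ≥0∞) :
    MemLp (ev p) q (volume.restrict S) := by
  have : IsFiniteMeasure (volume.restrict S) := ⟨by simpa using hS.measure_lt_top⟩
  obtain ⟨C, hC⟩ := hS.exists_bound_of_continuousOn (continuous_ev p).continuousOn
  exact MemLp.of_bound (continuous_ev p).aestronglyMeasurable C
    (ae_restrict_of_forall_mem hS.measurableSet hC)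

theorem norm_toLp_sq {p : PolyField} {S : Set R3} (h : MemLp (ev p) 2 (volume.restrict S)) :
    ‖h.toLp‖ ^ 2 = ∫ x in S, ‖ev p x‖ ^ 2 := by
  rw [← real_inner_self_eq_norm_sq, L2.inner_def]
  refine integral_congr_ae ?_
  filter_upwards [h.coeFn_toLp] with x hx
  rw [hx, real_inner_self_eq_norm_sq]

/-- The evaluation of polynomial fields in `L²(S)`, as a linear map. -/
noncomputable def toL2 {S : Set R3} (hS : IsCompact S) :
    PolyField →ₗ[ℝ] Lp R3 2 (volume.restrict S) where
  toFun p := (memLp_ev p hS 2).toLp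
  map_add' p q := by
    rw [← MemLp.toLp_add]
    exact MemLp.toLp_congr _ _ (Filter.Eventually.of_forall fun x => ev_add p q x)
  map_smul' c p := by
    rw [RingHom.id_apply, ← MemLp.toLp_const_smul]
    exact MemLp.toLp_congr _ _ (Filter.Eventually.of_forall fun x => ev_smul c p x)

/-- On the finite-dimensional space of polynomial fields of degree at most `r`, the `L²(S')` norm of
the curl is bounded by the `L²(S)` norm, whatever the position of the two compact sets. -/
theorem exists_integral_curl_le (r : ℕ) {S S' : Set R3} (hS : IsCompact S) (hS' : IsCompact S')
    (hne : (interior S).Nonempty) :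
    ∃ C : ℝ, 0 < C ∧ ∀ q ∈ polyDeg r,
      ∫ x in S', ‖ev (curl q) x‖ ^ 2 ≤ C ^ 2 * ∫ x in S, ‖ev q x‖ ^ 2 := by
  let curlL : PolyField →ₗ[ℝ] PolyField := ⟨⟨curl, curl_add⟩, curl_smul⟩
  let A : polyDeg r →ₗ[ℝ] Lp R3 2 (volume.restrict S) := toL2 hS ∘ₗ (polyDeg r).subtype
  let B : polyDeg r →ₗ[ℝ] Lp R3 2 (volume.restrict S') := toL2 hS' ∘ₗ curlL ∘ₗ (polyDeg r).subtype
  -- `A` is injective, so `B` factors through its finite-dimensional range, where it is bounded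
  have hA : Function.Injective A := by
    rw [← LinearMap.ker_eq_bot, LinearMap.ker_eq_bot']
    intro q hq
    have h0 : ‖(memLp_ev q.1 hS 2).toLp‖ ^ 2 = 0 := by
      have : ‖A q‖ ^ 2 = 0 := by rw [hq]; simp
      exact this
    rw [norm_toLp_sq] at h0
    exact Subtype.ext (eq_zero_of_integral_norm_sq_eq_zero hS hne h0)
  let e := LinearEquiv.ofInjective A hA
  let D := LinearMap.toContinuousLinearMap (B ∘ₗ e.symm.toLinearMap)
  refine ⟨‖D‖ + 1, by positivity, fun q hq => ?_⟩
  have h1 : D (e ⟨q, hq⟩) = B ⟨q, hq⟩ := by simp [D]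
  have h2 : ‖B ⟨q, hq⟩‖ ≤ (‖D‖ + 1) * ‖A ⟨q, hq⟩‖ := by
    rw [← h1]
    refine (D.le_opNorm _).trans ?_
    have : ‖e ⟨q, hq⟩‖ = ‖A ⟨q, hq⟩‖ := rfl
    rw [this]
    gcongr
    linarith
  have h3 : ‖B ⟨q, hq⟩‖ ^ 2 = ∫ x in S', ‖ev (curl q) x‖ ^ 2 := norm_toLp_sq (memLp_ev _ hS' 2)
  have h4 : ‖A ⟨q, hq⟩‖ ^ 2 = ∫ x in S, ‖ev q x‖ ^ 2 := norm_toLp_sq (memLp_ev _ hS 2)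
  rw [← h3, ← h4, ← mul_pow]
  gcongr

/-- The substitution `x ↦ c + ρ x` in polynomials. -/
noncomputable def affSubst (c : R3) (ρ : ℝ) :
    MvPolynomial (Fin 3) ℝ →ₐ[ℝ] MvPolynomial (Fin 3) ℝ :=
  MvPolynomial.aeval fun i => MvPolynomial.C (c i) + MvPolynomial.C ρ * MvPolynomial.X i

theorem evs_affSubst (c : R3) (ρ : ℝ) (p : MvPolynomial (Fin 3) ℝ) (y : R3) :
    evs (affSubst c ρ p) y = evs p (c + ρ • y) := by
  induction p using MvPolynomial.induction_on with
  | C a => simp [evs, affSubst]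
  | add p q hp hq => rw [map_add, evs_add, evs_add, hp, hq]
  | mul_X p i hp => rw [map_mul, evs_mul, evs_mul, hp]; simp [evs, affSubst]

theorem pderiv_affSubst (c : R3) (ρ : ℝ) (i : Fin 3) (p : MvPolynomial (Fin 3) ℝ) :
    MvPolynomial.pderiv i (affSubst c ρ p) = ρ • affSubst c ρ (MvPolynomial.pderiv i p) := by
  induction p using MvPolynomial.induction_on with
  | C a => simp [affSubst]
  | add p q hp hq => simp only [map_add, hp, hq, smul_add]
  | mul_X p j hp =>
    have hX : affSubst c ρ (MvPolynomial.X j)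
        = MvPolynomial.C (c j) + MvPolynomial.C ρ * MvPolynomial.X j := by simp [affSubst]
    simp only [map_mul, MvPolynomial.pderiv_mul, hp, map_add, hX, MvPolynomial.pderiv_C,
      MvPolynomial.pderiv_X, MvPolynomial.smul_eq_C_mul]
    rcases eq_or_ne j i with h | h
    · subst h; simp; ring
    · simp [h]; ring

theorem totalDegree_affSubst_le (c : R3) (ρ : ℝ) (p : MvPolynomial (Fin 3) ℝ) :
    (affSubst c ρ p).totalDegree ≤ p.totalDegree := by
  conv_lhs => rw [p.as_sum, map_sum]
  refine MvPolynomial.totalDegree_finsetSum_le fun s hs => ?_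
  refine le_trans ?_ (MvPolynomial.le_totalDegree hs)
  rw [affSubst, MvPolynomial.aeval_monomial, Finsupp.sum, Finsupp.prod]
  refine (MvPolynomial.totalDegree_mul _ _).trans ?_
  rw [MvPolynomial.algebraMap_eq, MvPolynomial.totalDegree_C, zero_add]
  refine (MvPolynomial.totalDegree_finsetProd _ _).trans (Finset.sum_le_sum fun i _ => ?_)
  refine (MvPolynomial.totalDegree_pow _ _).trans ?_
  have : (MvPolynomial.C (c i) + MvPolynomial.C ρ * MvPolynomial.X i :
      MvPolynomial (Fin 3) ℝ).totalDegree ≤ 1 := by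
    refine (MvPolynomial.totalDegree_add _ _).trans (max_le (by simp) ?_)
    refine (MvPolynomial.totalDegree_mul _ _).trans (by simp)
  nlinarith

theorem ev_curl_affSubst (c : R3) (ρ : ℝ) (q : PolyField) (y : R3) :
    ev (curl fun i => affSubst c ρ (q i)) y = ρ • ev (curl q) (c + ρ • y) := by
  ext i
  have h : ∀ j k, evs (MvPolynomial.pderiv j (affSubst c ρ (q k))) y
      = ρ * evs (MvPolynomial.pderiv j (q k)) (c + ρ • y) := fun j k => by
    rw [pderiv_affSubst, ← evs_affSubst]; simp [evs]
  rw [PiLp.smul_apply, ev_apply, ev_apply, smul_eq_mul]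
  fin_cases i <;> simp only [curl, Fin.zero_eta, Fin.mk_one, Fin.reduceFinMk, Matrix.cons_val] <;>
    rw [evs_sub, evs_sub, h, h] <;> ring

theorem setIntegral_affine (f : R3 → ℝ) (c : R3) {ρ : ℝ} (hρ : 0 < ρ) {S : Set R3}
    (hS : MeasurableSet S) :
    ∫ y in (fun y => c + ρ • y) ⁻¹' S, f (c + ρ • y) = (ρ ^ 3)⁻¹ * ∫ x in S, f x := by
  have hm : Measurable fun y : R3 => c + ρ • y := by fun_prop
  rw [← integral_indicator (hm hS), ← integral_indicator hS]
  have h := Measure.integral_comp_smul (volume : Measure R3) (fun x => S.indicator f (c + x)) ρ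
  rw [integral_add_left_eq_self (fun x => S.indicator f x) c] at h
  simp only [finrank_euclideanSpace, Fintype.card_fin, smul_eq_mul] at h
  rw [abs_of_pos (by positivity)] at h
  rw [← h]
  rfl

/-- The inverse inequality for the curl of polynomial fields on a set that contains a ball of radius
`ρ` and lies in a concentric one of radius `R ρ`. -/
theorem exists_inverse_inequality (r : ℕ) (R : ℝ) :
    ∃ C : ℝ, 0 < C ∧ ∀ q ∈ polyDeg r, ∀ (S : Set R3) (c : R3) (ρ : ℝ), 0 < ρ → IsCompact S →
      Metric.ball c ρ ⊆ S → S ⊆ Metric.closedBall c (R * ρ) →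
      ρ ^ 2 * ∫ x in S, ‖ev (curl q) x‖ ^ 2 ≤ C ^ 2 * ∫ x in S, ‖ev q x‖ ^ 2 := by
  obtain ⟨C, hC, h⟩ := exists_integral_curl_le r (isCompact_closedBall (0 : R3) 1)
    (isCompact_closedBall (0 : R3) R) (by
      rw [interior_closedBall _ one_ne_zero]; exact Metric.nonempty_ball.mpr one_pos)
  refine ⟨C, hC, fun q hq S c ρ hρ hS hin hout => ?_⟩
  have hq' : (fun i => affSubst c ρ (q i)) ∈ polyDeg r := by
    rw [mem_polyDeg] at hq ⊢
    exact fun i => (totalDegree_affSubst_le _ _ _).trans (hq i)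
  have h1 := h _ hq'
  have hev : ∀ y, ev (fun i => affSubst c ρ (q i)) y = ev q (c + ρ • y) := fun y => by
    ext i; exact evs_affSubst c ρ (q i) y
  have hpre : ∀ R : ℝ, (fun y => c + ρ • y) ⁻¹' Metric.closedBall c (R * ρ)
      = Metric.closedBall (0 : R3) R := fun R => by
    ext y
    simp [dist_eq_norm, norm_smul, abs_of_pos hρ, mul_comm R, mul_le_mul_iff_right₀ hρ]
  have hpre1 := hpre 1
  rw [one_mul] at hpre1
  simp only [ev_curl_affSubst, hev, norm_smul, mul_pow, Real.norm_eq_abs, sq_abs] at h1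
  rw [← hpre R, ← hpre1, integral_const_mul,
    setIntegral_affine (fun x => ‖ev (curl q) x‖ ^ 2) c hρ Metric.isClosed_closedBall.measurableSet,
    setIntegral_affine (fun x => ‖ev q x‖ ^ 2) c hρ Metric.isClosed_closedBall.measurableSet] at h1
  have h2 : ρ ^ 2 * ∫ x in Metric.closedBall c (R * ρ), ‖ev (curl q) x‖ ^ 2
      ≤ C ^ 2 * ∫ x in Metric.closedBall c ρ, ‖ev q x‖ ^ 2 := by
    have hp : 0 < ρ ^ 3 := by positivity
    rw [mul_left_comm, mul_left_comm (C ^ 2)] at h1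
    exact le_of_mul_le_mul_left h1 (by positivity)
  have hint : ∀ (p : PolyField) {S' : Set R3}, IsCompact S' →
      IntegrableOn (fun x => ‖ev p x‖ ^ 2) S' := fun p S' hS' =>
    (((continuous_ev p).norm).pow 2).continuousOn.integrableOn_compact hS'
  have hball : Metric.closedBall c ρ ⊆ S := by
    rw [← closure_ball c hρ.ne']
    exact closure_minimal hin hS.isClosed
  calc ρ ^ 2 * ∫ x in S, ‖ev (curl q) x‖ ^ 2
      ≤ ρ ^ 2 * ∫ x in Metric.closedBall c (R * ρ), ‖ev (curl q) x‖ ^ 2 := by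
        refine mul_le_mul_of_nonneg_left ?_ (by positivity)
        exact setIntegral_mono_set (hint _ (isCompact_closedBall _ _))
          (Filter.Eventually.of_forall fun x => by positivity) hout.eventuallyLE
    _ ≤ _ := h2
    _ ≤ _ := by
        refine mul_le_mul_of_nonneg_left ?_ (by positivity)
        exact setIntegral_mono_set (hint _ hS)
          (Filter.Eventually.of_forall fun x => by positivity) hball.eventuallyLE

theorem isCompact_hull (T : Finset R3) : IsCompact (hull T) :=
  T.finite_toSet.isCompact_convexHull (𝕜 := ℝ)

/-- The inverse inequality for the curl, with a constant that depends only on the shape regularity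
and on the degree. -/
theorem exists_inverseCurl (σ : ℝ) (r : ℕ) : ∃ C : ℝ, 0 < C ∧
    ∀ (Ω : Set R3) (M : Triangulation Ω) (V : Submodule ℝ (Broken M)),
      M.ShapeRegular σ → IsCurlConforming M V r → InverseCurl M V C := by
  obtain ⟨C, hC, h⟩ := exists_inverse_inequality r (2 * σ)
  refine ⟨(2 * |σ| + 1) * C, by positivity, fun Ω M V hσ hV v hv T => ?_⟩
  obtain ⟨c, ρ, hρ, hin, hd⟩ := hσ T
  have hK := isCompact_hull T.1
  have hout : hull T.1 ⊆ Metric.closedBall c (2 * σ * ρ) := fun x hx => by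
    rw [Metric.mem_closedBall]
    exact (Metric.dist_le_diam_of_mem hK.isBounded hx
      (hin (Metric.mem_ball_self hρ))).trans (by
        simpa [Triangulation.diam, mul_left_comm, mul_assoc] using hd)
  have h1 := h _ (curl_mem_polyDeg (mem_polyDeg.mpr (hV.degree_le v hv T))) _ c ρ hρ hK hin hout
  have hdpos : 0 < M.diam T := by
    have h2 : Metric.diam (Metric.ball c ρ) ≤ M.diam T := Metric.diam_mono hin hK.isBounded
    have h3 : Metric.diam (Metric.ball c ρ) ≠ 0 := by
      intro h0
      obtain ⟨v, hv⟩ : ∃ v : R3, ‖v‖ = ρ / 2 :=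
        ⟨EuclideanSpace.single 0 (ρ / 2), by simp [abs_of_pos hρ]⟩
      have := Metric.dist_le_diam_of_mem Metric.isBounded_ball
        (show c + v ∈ Metric.ball c ρ by simp [hv]; linarith) (Metric.mem_ball_self hρ)
      rw [h0] at this
      simp [hv] at this
      linarith
    exact lt_of_lt_of_le (lt_of_le_of_ne Metric.diam_nonneg h3.symm) h2
  have h2 : ρ * l2norm T.1 (ev (curl (curl (v T)))) ≤ C * l2norm T.1 (ev (curl (v T))) := by
    refine (pow_le_pow_iff_left₀ (by unfold l2norm; positivity) (by unfold l2norm; positivity)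
      two_ne_zero).mp ?_
    rw [mul_pow, mul_pow, l2norm, l2norm, Real.sq_sqrt (by positivity),
      Real.sq_sqrt (by positivity)]
    exact h1
  have h3 : M.diam T ≤ (2 * |σ| + 1) * ρ := by nlinarith [le_abs_self σ]
  have h4 : 0 ≤ l2norm T.1 (ev (curl (curl (v T)))) := Real.sqrt_nonneg _
  rw [mul_right_comm, ← div_eq_mul_inv, le_div_iff₀ hdpos]
  nlinarith [abs_nonneg σ]

/-! ### Weak gradients -/

/-- Here the scalar factor is the one with compact support in `U`. -/
theorem integrableOn_smul_of_tsupport {F : Type*} [NormedAddCommGroup F] [NormedSpace ℝ F]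
    {U : Set R3} {g : R3 → ℝ} {G : R3 → F} (hG : LocallyIntegrableOn G U) (hg : Continuous g)
    (hc : HasCompactSupport g) (hs : tsupport g ⊆ U) : IntegrableOn (fun x => g x • G x) U := by
  have h1 : IntegrableOn (fun x => g x • G x) (tsupport g) :=
    (hG.integrableOn_compact_subset hs hc).continuousOn_smul hg.continuousOn hc
  rw [integrableOn_iff_integrable_of_support_subset] at h1
  · exact h1.integrableOn
  · intro x hx
    refine subset_tsupport g ?_
    intro h0
    exact hx (by simp [h0])

/-- Here the vector factor is the one with compact support in `U`. -/
theorem integrableOn_smul_of_tsupport' {F : Type*} [NormedAddCommGroup F] [NormedSpace ℝ F]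
    {U : Set R3} {f : R3 → ℝ} {H : R3 → F} (hf : LocallyIntegrableOn f U) (hH : Continuous H)
    (hc : HasCompactSupport H) (hs : tsupport H ⊆ U) : IntegrableOn (fun x => f x • H x) U := by
  have h1 : IntegrableOn (fun x => f x • H x) (tsupport H) :=
    (hf.integrableOn_compact_subset hs hc).smul_continuousOn hH.continuousOn hc
  rw [integrableOn_iff_integrable_of_support_subset] at h1
  · exact h1.integrableOn
  · intro x hx
    refine subset_tsupport H ?_
    intro h0
    exact hx (by simp [h0])

theorem continuous_gradient {φ : R3 → ℝ} (h : ContDiff ℝ ∞ φ) : Continuous (gradient φ) :=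
  (InnerProductSpace.toDual ℝ R3).symm.continuous.comp (h.continuous_fderiv (by simp))

theorem support_gradient_subset (φ : R3 → ℝ) : Function.support (gradient φ) ⊆ tsupport φ := by
  intro x hx
  refine support_fderiv_subset ℝ fun h0 => hx ?_
  rw [gradient, h0, map_zero]

theorem tsupport_gradient_subset (φ : R3 → ℝ) : tsupport (gradient φ) ⊆ tsupport φ :=
  closure_minimal (support_gradient_subset φ) (isClosed_tsupport φ)

theorem hasCompactSupport_gradient {φ : R3 → ℝ} (h : HasCompactSupport φ) :
    HasCompactSupport (gradient φ) :=
  h.mono' (support_gradient_subset φ)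

/-- Weak gradients are unique up to null sets. -/
theorem IsWeakGrad.ae_eq {U : Set R3} (hU : IsOpen U) {f : R3 → ℝ} {G G' : R3 → R3}
    (h : IsWeakGrad U f G) (h' : IsWeakGrad U f G') : G =ᵐ[volume.restrict U] G' := by
  have key := hU.ae_eq_zero_of_integral_contDiff_smul_eq_zero (μ := volume)
    (f := fun x => G x - G' x) (h.locInt.sub h'.locInt) (fun g hg hc hs => by
      rw [← setIntegral_eq_integral_of_forall_compl_eq_zero (s := U) (fun x hx => by
        rw [image_eq_zero_of_notMem_tsupport (fun hx' => hx (hs hx')), zero_smul])]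
      simp only [smul_sub]
      rw [integral_sub (integrableOn_smul_of_tsupport h.locInt hg.continuous hc hs)
        (integrableOn_smul_of_tsupport h'.locInt hg.continuous hc hs), sub_eq_zero]
      have := (h.byParts g hg hc hs).symm.trans (h'.byParts g hg hc hs)
      exact neg_injective this)
  rw [Filter.EventuallyEq, ae_restrict_iff' hU.measurableSet]
  filter_upwards [key] with x hx hxU
  exact sub_eq_zero.mp (hx hxU)

theorem IsWeakGrad.weakGrad_ae_eq {U : Set R3} (hU : IsOpen U) {f : R3 → ℝ} {G : R3 → R3}
    (h : IsWeakGrad U f G) : weakGrad U f =ᵐ[volume.restrict U] G := by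
  have hex : ∃ G, IsWeakGrad U f G := ⟨G, h⟩
  rw [weakGrad, dif_pos hex]
  exact hex.choose_spec.ae_eq hU h

theorem IsWeakGrad.mono {U U' : Set R3} (hU : IsOpen U) (hsub : U' ⊆ U)
    {f : R3 → ℝ} {G : R3 → R3} (h : IsWeakGrad U f G) : IsWeakGrad U' f G where
  locInt := h.locInt.mono_set hsub
  byParts φ hφ hc hs := by
    have key := h.byParts φ hφ hc (hs.trans hsub)
    rwa [setIntegral_eq_of_subset_of_forall_sdiff_eq_zero hU.measurableSet hsub
      (fun x hx => ?_), setIntegral_eq_of_subset_of_forall_sdiff_eq_zero hU.measurableSet hsub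
      (fun x hx => ?_)] at key
    · rw [image_eq_zero_of_notMem_tsupport (fun hx' => hx.2 (hs hx')), zero_smul]
    · rw [image_eq_zero_of_notMem_tsupport (f := gradient φ)
        (fun hx' => hx.2 (hs (tsupport_gradient_subset φ hx'))), smul_zero]

theorem gradient_mul {q φ : R3 → ℝ} {x : R3} (hq : DifferentiableAt ℝ q x)
    (hφ : DifferentiableAt ℝ φ x) :
    gradient (fun y => q y * φ y) x = q x • gradient φ x + φ x • gradient q x := by
  unfold gradient
  rw [fderiv_fun_mul hq hφ, map_add]
  simp

/-- The product rule for a weakly differentiable function and a smooth one. -/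
theorem IsWeakGrad.mul_smooth {U : Set R3} (hU : IsOpen U) {f : R3 → ℝ} {G : R3 → R3}
    (h : IsWeakGrad U f G) (hf : LocallyIntegrableOn f U) {q : R3 → ℝ} (hq : ContDiff ℝ ∞ q) :
    IsWeakGrad U (fun x => q x * f x) (fun x => q x • G x + f x • gradient q x) where
  locInt := (h.locInt.continuousOn_smul hU.isLocallyClosed hq.continuous.continuousOn).add
    (hf.smul_continuousOn hU.isLocallyClosed (continuous_gradient hq).continuousOn)
  byParts φ hφ hc hs := by
    have hd : ∀ {g : R3 → ℝ}, ContDiff ℝ ∞ g → ∀ x, DifferentiableAt ℝ g x :=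
      fun hg x => (hg.differentiable (by simp)) x
    have hqφ : ContDiff ℝ ∞ fun y => q y * φ y := hq.mul hφ
    have hcs : HasCompactSupport fun y => q y * φ y := hc.mul_left
    have hss : tsupport (fun y => q y * φ y) ⊆ U := (tsupport_mul_subset_right).trans hs
    have key := h.byParts _ hqφ hcs hss
    -- the term with the derivative of `q`
    have hH : Continuous fun x => φ x • gradient q x := hφ.continuous.smul (continuous_gradient hq)
    have hHsub : tsupport (fun x => φ x • gradient q x) ⊆ tsupport φ :=
      closure_mono (fun x hx h0 => hx (by simp [h0]))
    have hHc : HasCompactSupport fun x => φ x • gradient q x := hc.smul_right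
    have i1 := integrableOn_smul_of_tsupport' hf (continuous_gradient hqφ)
      (hasCompactSupport_gradient hcs) ((tsupport_gradient_subset _).trans hss)
    have i2 := integrableOn_smul_of_tsupport' hf hH hHc (hHsub.trans hs)
    have i3 := integrableOn_smul_of_tsupport h.locInt hqφ.continuous hcs hss
    have e1 : ∫ x in U, (q x * f x) • gradient φ x
        = (∫ x in U, f x • gradient (fun y => q y * φ y) x)
          - ∫ x in U, f x • φ x • gradient q x := by
      rw [← integral_sub i1 i2]
      refine integral_congr_ae (Filter.Eventually.of_forall fun x => ?_)
      simp only [gradient_mul (hd hq x) (hd hφ x)]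
      module
    have e2 : ∫ x in U, φ x • (q x • G x + f x • gradient q x)
        = (∫ x in U, (q x * φ x) • G x) + ∫ x in U, f x • φ x • gradient q x := by
      rw [← integral_add i3 i2]
      refine integral_congr_ae (Filter.Eventually.of_forall fun x => ?_)
      simp only
      module
    rw [e1, e2, key]
    abel

theorem IsWeakGrad.add {U : Set R3} {f g : R3 → ℝ} {G H : R3 → R3}
    (hf : IsWeakGrad U f G) (hg : IsWeakGrad U g H) (hfl : LocallyIntegrableOn f U)
    (hgl : LocallyIntegrableOn g U) :
    IsWeakGrad U (fun x => f x + g x) (fun x => G x + H x) where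
  locInt := hf.locInt.add hg.locInt
  byParts φ hφ hc hs := by
    simp only [add_smul, smul_add]
    have hgr := continuous_gradient hφ
    have hgc := hasCompactSupport_gradient hc
    have hgs := (tsupport_gradient_subset φ).trans hs
    rw [integral_add (integrableOn_smul_of_tsupport' hfl hgr hgc hgs)
        (integrableOn_smul_of_tsupport' hgl hgr hgc hgs),
      integral_add (integrableOn_smul_of_tsupport hf.locInt hφ.continuous hc hs)
        (integrableOn_smul_of_tsupport hg.locInt hφ.continuous hc hs),
      hf.byParts φ hφ hc hs, hg.byParts φ hφ hc hs, neg_add]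

/-! ### Orthonormal coordinates adapted to a plane -/

/-- The Euclidean plane. -/
abbrev R2 : Type := EuclideanSpace ℝ (Fin 2)

/-- The linear part of the parametrization of a plane spanned by `e 1` and `e 2`. -/
noncomputable def planeLin (e : OrthonormalBasis (Fin 3) ℝ R3) : R2 →ₗ[ℝ] R3 where
  toFun y := y 0 • e 1 + y 1 • e 2
  map_add' y z := by simp only [PiLp.add_apply]; module
  map_smul' c y := by simp only [PiLp.smul_apply, smul_eq_mul, RingHom.id_apply]; module

/-- The point at the distance `s` from the plane through `x₀` spanned by `e 1` and `e 2`, over the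
point of the plane with the coordinates `y`. -/
noncomputable def frame (e : OrthonormalBasis (Fin 3) ℝ R3) (x₀ : R3) (s : ℝ) (y : R2) : R3 :=
  x₀ + (s • e 0 + planeLin e y)

theorem inner_frame_sub (e : OrthonormalBasis (Fin 3) ℝ R3) (x₀ : R3) (s : ℝ) (y : R2) :
    ⟪e 0, frame e x₀ s y - x₀⟫_ℝ = s := by
  have h := e.orthonormal
  have h00 : ⟪e 0, e 0⟫_ℝ = 1 := by rw [real_inner_self_eq_norm_sq, h.1]; norm_num
  have h01 : ⟪e 0, e 1⟫_ℝ = 0 := h.2 (by decide)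
  have h02 : ⟪e 0, e 2⟫_ℝ = 0 := h.2 (by decide)
  simp [frame, planeLin, inner_add_right, inner_smul_right, h01, h02]

theorem norm_sq_planeLin (e : OrthonormalBasis (Fin 3) ℝ R3) (y : R2) :
    ‖planeLin e y‖ ^ 2 = ‖y‖ ^ 2 := by
  have h := e.orthonormal
  have h12 : ⟪e 1, e 2⟫_ℝ = 0 := h.2 (by decide)
  rw [EuclideanSpace.norm_sq_eq y, Fin.sum_univ_two]
  change ‖y 0 • e 1 + y 1 • e 2‖ ^ 2 = _
  rw [norm_add_sq_real, inner_smul_left, inner_smul_right, h12, norm_smul, norm_smul, h.1, h.1]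
  simp

theorem norm_planeLin (e : OrthonormalBasis (Fin 3) ℝ R3) (y : R2) : ‖planeLin e y‖ = ‖y‖ := by
  have := norm_sq_planeLin e y
  rwa [sq_eq_sq₀ (norm_nonneg _) (norm_nonneg _)] at this

theorem norm_le_norm_frame_sub (e : OrthonormalBasis (Fin 3) ℝ R3) (x₀ : R3) (s : ℝ) (y : R2) :
    ‖y‖ ≤ ‖frame e x₀ s y - x₀‖ := by
  have h := e.orthonormal
  have h01 : ⟪e 0, e 1⟫_ℝ = 0 := h.2 (by decide)
  have h02 : ⟪e 0, e 2⟫_ℝ = 0 := h.2 (by decide)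
  have h0 : ⟪e 0, planeLin e y⟫_ℝ = 0 := by
    simp [planeLin, inner_add_right, inner_smul_right, h01, h02]
  refine (pow_le_pow_iff_left₀ (norm_nonneg _) (norm_nonneg _) two_ne_zero).mp ?_
  rw [frame, add_sub_cancel_left, norm_add_sq_real, norm_sq_planeLin, inner_smul_left, h0]
  nlinarith [sq_nonneg ‖s • e 0‖]

theorem continuous_frame (e : OrthonormalBasis (Fin 3) ℝ R3) (x₀ : R3) :
    Continuous fun p : ℝ × R2 => frame e x₀ p.1 p.2 := by
  have := (planeLin e).continuous_of_finiteDimensional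
  unfold frame
  fun_prop

theorem isometry_frame (e : OrthonormalBasis (Fin 3) ℝ R3) (x₀ : R3) :
    Isometry fun y => frame e x₀ 0 y := by
  refine Isometry.of_dist_eq fun y z => ?_
  rw [dist_eq_norm, dist_eq_norm, frame, frame, ← norm_planeLin e (y - z), map_sub]
  congr 1
  abel

theorem range_frame (e : OrthonormalBasis (Fin 3) ℝ R3) (x₀ : R3) :
    range (fun y => frame e x₀ 0 y) = {x | ⟪e 0, x - x₀⟫_ℝ = 0} := by
  ext x
  constructor
  · rintro ⟨y, rfl⟩
    exact inner_frame_sub e x₀ 0 y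
  · intro hx
    have h := e.sum_repr' (x - x₀)
    rw [Fin.sum_univ_three, hx.out] at h
    refine ⟨!₂[⟪e 1, x - x₀⟫_ℝ, ⟪e 2, x - x₀⟫_ℝ], ?_⟩
    simp only [zero_smul, zero_add] at h
    simp only [frame, planeLin, LinearMap.coe_mk, AddHom.coe_mk, zero_smul, zero_add]
    change x₀ + (⟪e 1, x - x₀⟫_ℝ • e 1 + ⟪e 2, x - x₀⟫_ℝ • e 2) = x
    rw [h]; abel

theorem measurePreserving_frame (e : OrthonormalBasis (Fin 3) ℝ R3) (x₀ : R3) :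
    MeasurePreserving (fun p : ℝ × R2 => frame e x₀ p.1 p.2) := by
  have h1 : MeasurePreserving (Prod.map id (MeasurableEquiv.toLp 2 (Fin 2 → ℝ)).symm :
      ℝ × R2 → ℝ × (Fin 2 → ℝ)) :=
    (MeasurePreserving.id volume).prod
      (EuclideanSpace.volume_preserving_symm_measurableEquiv_toLp (Fin 2))
  have h2 := (volume_preserving_piFinSuccAbove (fun _ : Fin 3 => ℝ) 0).symm
  have h3 : MeasurePreserving (MeasurableEquiv.toLp 2 (Fin 3 → ℝ)) :=
    (EuclideanSpace.volume_preserving_symm_measurableEquiv_toLp (Fin 3)).symm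
  have h4 := e.measurePreserving_repr_symm
  have h5 := measurePreserving_add_left (volume : Measure R3) x₀
  have h := h5.comp (h4.comp (h3.comp (h2.comp h1)))
  refine (congrArg (fun F : ℝ × R2 → R3 => MeasurePreserving F) ?_).mpr h
  funext ⟨s, y⟩
  simp only [frame, Function.comp_apply, planeLin, LinearMap.coe_mk, AddHom.coe_mk]
  congr 1
  rw [← e.sum_repr_symm, Fin.sum_univ_three, ← add_assoc]
  rfl

/-- Integration in the coordinates of a frame, with the normal coordinate scaled by `κ`. -/
theorem integral_frame (e : OrthonormalBasis (Fin 3) ℝ R3) (x₀ : R3) {κ : ℝ} (hκ : 0 < κ)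
    {g : R3 → ℝ} (hg : Measurable g) :
    ∫ x, g x = κ * ∫ p : ℝ × R2, g (frame e x₀ (κ * p.1) p.2) := by
  have hs : MeasurePreserving (fun t : ℝ => κ * t) (ENNReal.ofReal κ • volume) volume := by
    refine ⟨by fun_prop, ?_⟩
    rw [Measure.map_smul]
    simpa [abs_of_pos hκ] using Real.smul_map_volume_mul_left hκ.ne'
  have hp := (measurePreserving_frame e x₀).comp
    (hs.prod (MeasurePreserving.id (volume : Measure R2)))
  have h1 := integral_map
    (μ := (ENNReal.ofReal κ • (volume : Measure ℝ)).prod (volume : Measure R2))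
    hp.measurable.aemeasurable (f := g) hg.aestronglyMeasurable
  rw [hp.map_eq] at h1
  rw [h1, Measure.prod_smul_left, integral_smul_measure, ENNReal.toReal_ofReal hκ.le, smul_eq_mul]
  rfl

theorem map_frame_volume (e : OrthonormalBasis (Fin 3) ℝ R3) (x₀ : R3) :
    Measure.map (fun y => frame e x₀ 0 y) volume
      = (Measure.euclideanHausdorffMeasure 2 : Measure R3).restrict {x | ⟪e 0, x - x₀⟫_ℝ = 0} := by
  rw [← range_frame, ← (isometry_frame e x₀).map_euclideanHausdorffMeasure,
    EuclideanSpace.euclideanHausdorffMeasure_eq_volume]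

/-- The area measure of a subset of a plane in the coordinates of the plane. -/
theorem restrict_euclideanHausdorffMeasure (e : OrthonormalBasis (Fin 3) ℝ R3) (x₀ : R3)
    {F : Set R3} (hF : MeasurableSet F) (hsub : F ⊆ {x | ⟪e 0, x - x₀⟫_ℝ = 0}) :
    (Measure.euclideanHausdorffMeasure 2 : Measure R3).restrict F
      = Measure.map (fun y => frame e x₀ 0 y)
          (volume.restrict ((fun y => frame e x₀ 0 y) ⁻¹' F)) := by
  rw [← Measure.restrict_map (isometry_frame e x₀).continuous.measurable hF, map_frame_volume,
    Measure.restrict_restrict hF, inter_eq_left.mpr hsub]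

theorem integral_euclideanHausdorffMeasure (e : OrthonormalBasis (Fin 3) ℝ R3) (x₀ : R3)
    {F : Set R3} (hF : MeasurableSet F) (hsub : F ⊆ {x | ⟪e 0, x - x₀⟫_ℝ = 0}) (f : R3 → ℝ) :
    ∫ x in F, f x ∂(Measure.euclideanHausdorffMeasure 2)
      = ∫ y in (fun y => frame e x₀ 0 y) ⁻¹' F, f (frame e x₀ 0 y) := by
  rw [restrict_euclideanHausdorffMeasure e x₀ hF hsub]
  exact (isometry_frame e x₀).isClosedEmbedding.measurableEmbedding.integral_map _

theorem euclideanHausdorffMeasure_lt_top (e : OrthonormalBasis (Fin 3) ℝ R3) (x₀ : R3) {F : Set R3}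
    (hF : IsCompact F) (hsub : F ⊆ {x | ⟪e 0, x - x₀⟫_ℝ = 0}) :
    (Measure.euclideanHausdorffMeasure 2 : Measure R3) F < ⊤ := by
  have h := restrict_euclideanHausdorffMeasure e x₀ hF.measurableSet hsub
  have h1 : (Measure.euclideanHausdorffMeasure 2 : Measure R3) F
      = (Measure.euclideanHausdorffMeasure 2 : Measure R3).restrict F univ := by simp
  rw [h1, h, Measure.map_apply (isometry_frame e x₀).continuous.measurable MeasurableSet.univ]
  simp only [preimage_univ, Measure.restrict_apply_univ]
  exact ((isometry_frame e x₀).isClosedEmbedding.isCompact_preimage hF).measure_lt_top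

theorem exists_orthonormalBasis_zero_eq {m : R3} (hm : ‖m‖ = 1) :
    ∃ e : OrthonormalBasis (Fin 3) ℝ R3, e 0 = m := by
  obtain ⟨b, hb⟩ := Orthonormal.exists_orthonormalBasis_extension_of_card_eq (𝕜 := ℝ) (E := R3)
    (ι := Fin 3) (by simp) (v := fun _ => m) (s := {0}) (by
      refine ⟨fun i => hm, fun i j hij => absurd (Subtype.ext (i.2.trans j.2.symm)) hij⟩)
  exact ⟨b, hb 0 rfl⟩

theorem volume_linear_eq_zero {ℓ : R2 →ₗ[ℝ] ℝ} (hℓ : ℓ ≠ 0) (d : ℝ) :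
    volume {y | ℓ y = d} = 0 := by
  let s : AffineSubspace ℝ R2 := (AffineSubspace.mk' d ⊥).comap ℓ.toAffineMap
  have hs : (s : Set R2) = {y | ℓ y = d} := by
    ext y; simp [s, sub_eq_zero]
  rw [← hs]
  refine Measure.addHaar_affineSubspace _ _ fun htop => hℓ ?_
  have hall : ∀ y, ℓ y = d := fun y => by
    have : y ∈ (s : Set R2) := by rw [htop]; trivial
    rwa [hs] at this
  have hd : d = 0 := by rw [← hall 0, map_zero]
  ext y
  simp [hall, hd]

open Filter Topology

/-! ### Boundary layers of a simplex -/

/-- A smooth monotone function that is `0` on `(-∞, 1]` and `1` on `[2, ∞)`. -/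
noncomputable def cutoff (t : ℝ) : ℝ := Real.smoothTransition (t - 1)

theorem contDiff_cutoff : ContDiff ℝ ∞ cutoff :=
  Real.smoothTransition.contDiff.comp (contDiff_id.sub contDiff_const)

theorem continuous_cutoff : Continuous cutoff := contDiff_cutoff.continuous

theorem continuous_deriv_cutoff : Continuous (deriv cutoff) :=
  contDiff_cutoff.continuous_deriv (by simp)

theorem cutoff_eq_zero {t : ℝ} (h : t ≤ 1) : cutoff t = 0 :=
  Real.smoothTransition.zero_of_nonpos (by linarith)

theorem cutoff_eq_one {t : ℝ} (h : 2 ≤ t) : cutoff t = 1 :=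
  Real.smoothTransition.one_of_one_le (by linarith)

theorem cutoff_nonneg (t : ℝ) : 0 ≤ cutoff t := Real.smoothTransition.nonneg _

theorem cutoff_le_one (t : ℝ) : cutoff t ≤ 1 := Real.smoothTransition.le_one _

theorem deriv_cutoff_of_lt {t : ℝ} (h : t < 1) : deriv cutoff t = 0 := by
  have : cutoff =ᶠ[𝓝 t] fun _ => 0 := by
    filter_upwards [Iio_mem_nhds h] with s hs using cutoff_eq_zero hs.out.le
  rw [this.deriv_eq, deriv_const]

theorem deriv_cutoff_of_gt {t : ℝ} (h : 2 < t) : deriv cutoff t = 0 := by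
  have : cutoff =ᶠ[𝓝 t] fun _ => 1 := by
    filter_upwards [Ioi_mem_nhds h] with s hs using cutoff_eq_one hs.out.le
  rw [this.deriv_eq, deriv_const]

theorem integrable_deriv_cutoff : Integrable (deriv cutoff) := by
  refine continuous_deriv_cutoff.integrable_of_hasCompactSupport ?_
  refine HasCompactSupport.of_support_subset_isCompact (isCompact_Icc (a := (1 : ℝ)) (b := 2)) ?_
  intro t ht
  by_contra hn
  rw [mem_Icc, not_and_or, not_le, not_le] at hn
  exact ht (hn.elim deriv_cutoff_of_lt deriv_cutoff_of_gt)

theorem integral_deriv_cutoff : ∫ t, deriv cutoff t = 1 := by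
  rw [integral_of_hasDerivAt_of_tendsto (f := cutoff) (m := 0) (n := 1)
    (fun t => ((contDiff_cutoff.differentiable (by simp)) t).hasDerivAt) integrable_deriv_cutoff]
  · simp
  · refine tendsto_const_nhds.congr' ?_
    filter_upwards [eventually_le_atBot 1] with t ht using (cutoff_eq_zero ht).symm
  · refine tendsto_const_nhds.congr' ?_
    filter_upwards [eventually_ge_atTop 2] with t ht using (cutoff_eq_one ht).symm

section Simplex

variable {ι : Type*} (b : AffineBasis ι ℝ R3)

theorem continuous_coord (a : ι) : Continuous (b.coord a) :=
  (b.coord a).continuous_of_finiteDimensional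

theorem isCompact_convexHull_range [Finite ι] : IsCompact (convexHull ℝ (range b)) :=
  (finite_range b).isCompact_convexHull (𝕜 := ℝ)

theorem prod_cutoff_nonneg (s : Finset ι) (k : ℕ) (x : R3) :
    0 ≤ ∏ j ∈ s, cutoff (k * b.coord j x) :=
  Finset.prod_nonneg fun _ _ => cutoff_nonneg _

theorem prod_cutoff_le_one (s : Finset ι) (k : ℕ) (x : R3) :
    ∏ j ∈ s, cutoff (k * b.coord j x) ≤ 1 :=
  Finset.prod_le_one (fun _ _ => cutoff_nonneg _) fun _ _ => cutoff_le_one _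

/-- If all coordinates in `s` of the limit of `X k` are positive, the cutoff functions are
eventually equal to one at `X k`. -/
theorem eventually_prod_cutoff_eq_one (s : Finset ι) {X : ℕ → R3} {z : R3}
    (hX : Tendsto X atTop (𝓝 z)) (hz : ∀ j ∈ s, 0 < b.coord j z) :
    ∀ᶠ k : ℕ in atTop, ∏ j ∈ s, cutoff (k * b.coord j (X k)) = 1 := by
  have h : ∀ j ∈ s, ∀ᶠ k : ℕ in atTop, cutoff (k * b.coord j (X k)) = 1 := fun j hj => by
    have h1 : Tendsto (fun k => b.coord j (X k)) atTop (𝓝 (b.coord j z)) :=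
      ((continuous_coord b j).tendsto z).comp hX
    have h2 := tendsto_natCast_atTop_atTop (R := ℝ) |>.atTop_mul_pos (hz j hj) h1
    filter_upwards [h2.eventually_ge_atTop 2] with k hk using cutoff_eq_one hk
  filter_upwards [(Filter.eventually_all_finset s).mpr h] with k hk
  exact Finset.prod_eq_one hk

variable [Fintype ι] [DecidableEq ι]

/-- An edge is a null set in the plane of a facet: the barycentric coordinate of a vertex of the
facet is a nonconstant affine function on that plane. -/
theorem volume_coord_frame_eq_zero {a j : ι} (hj : j ≠ a) (e : OrthonormalBasis (Fin 3) ℝ R3)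
    (x₀ : R3) {c : ℝ} (hc : 0 < c) (hcoord : ∀ x, b.coord a x = ⟪e 0, x - x₀⟫_ℝ / c) :
    volume {y | b.coord j (frame e x₀ 0 y) = 0} = 0 := by
  have hlin : ∀ y, b.coord j (frame e x₀ 0 y)
      = ((b.coord j).linear ∘ₗ planeLin e) y + b.coord j x₀ := fun y => by
    have := (b.coord j).map_vadd x₀ (planeLin e y)
    simp only [vadd_eq_add] at this
    rw [frame, zero_smul, zero_add, add_comm, this]
    rfl
  have hne : ((b.coord j).linear ∘ₗ planeLin e) ≠ 0 := by
    intro h0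
    have hcard : Fintype.card ι = 4 := by rw [b.card_eq_finrank_add_one]; simp
    obtain ⟨i, hi⟩ : ∃ i, i ∉ ({a, j} : Finset ι) := by
      by_contra hall
      push Not at hall
      have h1 := Finset.card_le_card (fun x _ => hall x : (Finset.univ : Finset ι) ⊆ {a, j})
      have h2 := Finset.card_le_two (a := a) (b := j)
      rw [Finset.card_univ] at h1
      omega
    simp only [Finset.mem_insert, Finset.mem_singleton, not_or] at hi
    have hmem : ∀ l, l ≠ a → b.coord j (b l) = b.coord j x₀ := fun l hl => by
      have h1 : b l ∈ range fun y => frame e x₀ 0 y := by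
        rw [range_frame]
        have h2 := hcoord (b l)
        rw [b.coord_apply_ne hl.symm] at h2
        rcases div_eq_zero_iff.mp h2.symm with h | h
        · exact h
        · exact absurd h hc.ne'
      obtain ⟨y, hy⟩ := h1
      rw [← hy]
      simp only [hlin, h0, LinearMap.zero_apply, zero_add]
    have h3 := (hmem j hj).trans (hmem i hi.1).symm
    rw [b.coord_apply_eq, b.coord_apply_ne (Ne.symm hi.2)] at h3
    exact one_ne_zero h3
  have := volume_linear_eq_zero hne (-b.coord j x₀)
  simpa only [hlin, add_eq_zero_iff_eq_neg] using this

/-- The weight on a layer of width `O(1/k)` along the facet opposite to `a`, which comes from the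
derivative of the cutoff function in the direction of that facet. -/
noncomputable def layer (a : ι) (k : ℕ) (x : R3) : ℝ :=
  k * deriv cutoff (k * b.coord a x) * ∏ j ∈ Finset.univ.erase a, cutoff (k * b.coord j x)

theorem continuous_layer (a : ι) (k : ℕ) : Continuous (layer b a k) := by
  have h := fun j => continuous_coord b j
  have h1 := continuous_cutoff
  have h2 := continuous_deriv_cutoff
  unfold layer
  fun_prop

/-- The integrals over the layers converge to the integral over the facet. -/
theorem tendsto_integral_layer (a : ι) (e : OrthonormalBasis (Fin 3) ℝ R3)
    (x₀ : R3) {c : ℝ} (hc : 0 < c) (hcoord : ∀ x, b.coord a x = ⟪e 0, x - x₀⟫_ℝ / c)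
    {f : R3 → ℝ} (hf : ContinuousOn f (convexHull ℝ (range b))) :
    Tendsto (fun k : ℕ => ∫ x in convexHull ℝ (range b), f x * layer b a k x) atTop
      (𝓝 (c * ∫ x in {x | x ∈ convexHull ℝ (range b) ∧ b.coord a x = 0}, f x
        ∂(Measure.euclideanHausdorffMeasure 2))) := by
  set K := convexHull ℝ (range b) with hKdef
  have hK : IsCompact K := isCompact_convexHull_range b
  have hKm : MeasurableSet K := hK.measurableSet
  have hKmem : ∀ x, x ∈ K ↔ ∀ j, 0 ≤ b.coord j x := fun x => by
    rw [hKdef, b.convexHull_eq_nonneg_coord]; rfl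
  have hfm : Measurable (K.indicator f) := by
    classical
    rw [← piecewise_eq_indicator]
    exact hf.measurable_piecewise continuousOn_const hKm
  obtain ⟨C, hC⟩ := hK.exists_bound_of_continuousOn hf
  have hfb : ∀ x, |K.indicator f x| ≤ |C| := fun x => by
    by_cases hx : x ∈ K
    · rw [indicator_of_mem hx]; exact (hC x hx).trans (le_abs_self C)
    · rw [indicator_of_notMem hx]; simp
  obtain ⟨R, hR⟩ := hK.isBounded.subset_closedBall x₀
  -- the integrand in the coordinates `(t, y)`, where `c t / k` is the distance from the facet
  let H : ℕ → ℝ × R2 → ℝ := fun k p => deriv cutoff p.1 *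
    (K.indicator f (frame e x₀ (c / k * p.1) p.2) *
      ∏ j ∈ Finset.univ.erase a, cutoff (k * b.coord j (frame e x₀ (c / k * p.1) p.2)))
  have hfr : ∀ k : ℕ, Continuous fun p : ℝ × R2 => frame e x₀ (c / k * p.1) p.2 := fun k =>
    (continuous_frame e x₀).comp ((continuous_const.mul continuous_fst).prodMk continuous_snd)
  have hcoordf : ∀ s y, b.coord a (frame e x₀ s y) = s / c := fun s y => by
    rw [hcoord, inner_frame_sub]
  have hH : ∀ k : ℕ, 0 < k → ∫ x in K, f x * layer b a k x = c * ∫ p, H k p := fun k hk => by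
    have hk' : (0 : ℝ) < k := by exact_mod_cast hk
    have h1 : ∀ x, K.indicator (fun x => f x * layer b a k x) x = K.indicator f x * layer b a k x :=
      fun x => by by_cases hx : x ∈ K <;> simp [hx]
    rw [← integral_indicator hKm]
    simp only [h1]
    rw [integral_frame e x₀ (κ := c / k) (by positivity)
      (g := fun x => K.indicator f x * layer b a k x)
      (hfm.mul (continuous_layer b a k).measurable), div_mul_eq_mul_div, mul_div_assoc,
      ← integral_div]
    congr 2
    funext p
    simp only [H, layer, hcoordf]
    rw [show (k : ℝ) * (c / k * p.1 / c) = p.1 by field_simp]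
    field_simp
  have hmeas : ∀ k, AEStronglyMeasurable (H k) := fun k => by
    refine Measurable.aestronglyMeasurable ?_
    have hd := continuous_deriv_cutoff.measurable
    refine (hd.comp measurable_fst).mul ((hfm.comp (hfr k).measurable).mul ?_)
    refine Continuous.measurable ?_
    refine continuous_finsetProd _ fun j _ => continuous_cutoff.comp (continuous_const.mul ?_)
    exact (continuous_coord b j).comp (hfr k)
  have hbound_int : Integrable (fun p : ℝ × R2 => |deriv cutoff p.1| *
      (Metric.closedBall (0 : R2) R).indicator (fun _ => |C|) p.2) := by
    refine Integrable.mul_prod integrable_deriv_cutoff.abs ?_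
    rw [integrable_indicator_iff Metric.isClosed_closedBall.measurableSet]
    exact integrableOn_const (isCompact_closedBall _ _).measure_lt_top.ne
  have hbound : ∀ k p, ‖H k p‖ ≤ |deriv cutoff p.1| *
      (Metric.closedBall (0 : R2) R).indicator (fun _ => |C|) p.2 := fun k p => by
    rw [Real.norm_eq_abs, abs_mul, abs_mul, abs_of_nonneg (prod_cutoff_nonneg b _ _ _)]
    refine mul_le_mul_of_nonneg_left ?_ (abs_nonneg _)
    by_cases hy : p.2 ∈ Metric.closedBall (0 : R2) R
    · rw [indicator_of_mem hy]
      calc _ ≤ |C| * 1 := mul_le_mul (hfb _) (prod_cutoff_le_one b _ _ _)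
            (prod_cutoff_nonneg b _ _ _) (abs_nonneg _)
        _ = |C| := mul_one _
    · rw [indicator_of_notMem hy]
      have : frame e x₀ (c / k * p.1) p.2 ∉ K := fun hmem => hy <| by
        have h1 := hR hmem
        rw [Metric.mem_closedBall, dist_eq_norm] at h1
        rw [mem_closedBall_zero_iff]
        exact (norm_le_norm_frame_sub e x₀ _ _).trans h1
      rw [indicator_of_notMem this]
      simp
  have hnull : ∀ᵐ p : ℝ × R2, ∀ j ∈ Finset.univ.erase a, b.coord j (frame e x₀ 0 p.2) ≠ 0 := by
    rw [Filter.eventually_all_finset]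
    intro j hj
    have h1 : ∀ᵐ y : R2, b.coord j (frame e x₀ 0 y) ≠ 0 := by
      rw [ae_iff]
      simpa using volume_coord_frame_eq_zero b (Finset.ne_of_mem_erase hj) e x₀ hc hcoord
    exact Measure.quasiMeasurePreserving_snd.ae h1
  have hlim : ∀ᵐ p : ℝ × R2, Tendsto (fun k => H k p) atTop
      (𝓝 (deriv cutoff p.1 * K.indicator f (frame e x₀ 0 p.2))) := by
    filter_upwards [hnull] with p hp
    -- for `p.1 < 1` both sides vanish; otherwise the points are on the inner side of the facet
    rcases lt_or_ge p.1 1 with ht | ht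
    · simp [H, deriv_cutoff_of_lt ht]
    refine Tendsto.const_mul _ ?_
    set X : ℕ → R3 := fun k => frame e x₀ (c / k * p.1) p.2 with hXdef
    have hX : Tendsto X atTop (𝓝 (frame e x₀ 0 p.2)) := by
      have h1 : Tendsto (fun k : ℕ => c / k * p.1) atTop (𝓝 0) := by
        simpa using (tendsto_const_div_atTop_nhds_zero_nat c).mul_const p.1
      have h2 : Continuous fun s => frame e x₀ s p.2 := by unfold frame; fun_prop
      exact (h2.tendsto 0).comp h1
    by_cases hz : frame e x₀ 0 p.2 ∈ K
    · have hpos : ∀ j ∈ Finset.univ.erase a, 0 < b.coord j (frame e x₀ 0 p.2) := fun j hj =>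
        lt_of_le_of_ne ((hKmem _).mp hz j) (hp j hj).symm
      have hmem : ∀ᶠ k in atTop, X k ∈ K := by
        have h1 : ∀ j ∈ Finset.univ.erase a, ∀ᶠ k in atTop, 0 < b.coord j (X k) := fun j hj =>
          hX.eventually ((isOpen_lt continuous_const (continuous_coord b j)).mem_nhds (hpos j hj))
        filter_upwards [(Filter.eventually_all_finset _).mpr h1] with k hk
        refine (hKmem _).mpr fun j => ?_
        rcases eq_or_ne j a with rfl | hj
        · rw [hXdef]
          simp only [hcoordf]
          positivity
        · exact (hk j (Finset.mem_erase.mpr ⟨hj, Finset.mem_univ _⟩)).le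
      have hfX : Tendsto (fun k => f (X k)) atTop (𝓝 (f (frame e x₀ 0 p.2))) :=
        (hf _ hz).tendsto.comp (tendsto_nhdsWithin_iff.mpr ⟨hX, hmem⟩)
      rw [indicator_of_mem hz]
      refine hfX.congr' ?_
      filter_upwards [hmem, eventually_prod_cutoff_eq_one b _ hX hpos] with k h1 h2
      rw [h2, indicator_of_mem h1, mul_one]
    · rw [indicator_of_notMem hz]
      refine tendsto_const_nhds.congr' ?_
      have hev : ∀ᶠ k in atTop, X k ∈ Kᶜ := hX.eventually (hK.isClosed.isOpen_compl.mem_nhds hz)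
      filter_upwards [hev] with k hk
      rw [indicator_of_notMem hk, zero_mul]
  have hconv := tendsto_integral_of_dominated_convergence _ hmeas hbound_int
    (fun k => Eventually.of_forall (hbound k)) hlim
  have hval : ∫ p : ℝ × R2, deriv cutoff p.1 * K.indicator f (frame e x₀ 0 p.2)
      = ∫ x in {x | x ∈ K ∧ b.coord a x = 0}, f x ∂(Measure.euclideanHausdorffMeasure 2) := by
    have h1 := integral_prod_mul (μ := (volume : Measure ℝ)) (ν := (volume : Measure R2))
      (deriv cutoff) (fun y => K.indicator f (frame e x₀ 0 y))
    rw [integral_deriv_cutoff, one_mul] at h1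
    have hFm : MeasurableSet {x | x ∈ K ∧ b.coord a x = 0} :=
      hKm.inter ((isClosed_singleton (x := (0 : ℝ))).preimage (continuous_coord b a)).measurableSet
    have h2 := integral_euclideanHausdorffMeasure e x₀ hFm (fun x hx => by
      have h3 := hcoord x
      rw [hx.2] at h3
      rcases div_eq_zero_iff.mp h3.symm with h | h
      · exact h
      · exact absurd h hc.ne') f
    rw [h2]
    refine h1.trans ?_
    have h4 : (fun y => frame e x₀ 0 y) ⁻¹' {x | x ∈ K ∧ b.coord a x = 0}
        = (fun y => frame e x₀ 0 y) ⁻¹' K := by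
      ext y; simp [hcoordf]
    rw [h4, ← integral_indicator ((isometry_frame e x₀).continuous.measurable hKm)]
    rfl
  rw [hval] at hconv
  refine (hconv.const_mul c).congr' ?_
  filter_upwards [eventually_gt_atTop 0] with k hk using (hH k hk).symm

end Simplex

section Simplex

variable {ι : Type*} (b : AffineBasis ι ℝ R3)

/-! ### The divergence theorem on a simplex -/

/-- A smooth function that vanishes near the boundary of the simplex and is one away from it. -/
noncomputable def bubble [Fintype ι] (k : ℕ) (x : R3) : ℝ := ∏ j, cutoff (k * b.coord j x)

theorem hasGradientAt_coord {a : ι} {n x₀ : R3} {c : ℝ}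
    (hcoord : ∀ x, b.coord a x = -⟪n, x - x₀⟫_ℝ / c) (x : R3) :
    HasGradientAt (b.coord a) (-(1 / c) • n) x := by
  have h : (b.coord a : R3 → ℝ) = fun x => ⟪-(1 / c) • n, x⟫_ℝ + ⟪n, x₀⟫_ℝ / c := by
    funext y
    rw [hcoord, inner_sub_right, inner_smul_left]
    simp; ring
  rw [h, hasGradientAt_iff_hasFDerivAt]
  exact ((InnerProductSpace.toDual ℝ R3 (-(1 / c) • n)).hasFDerivAt).add_const _

theorem contDiff_coord {a : ι} {n x₀ : R3} {c : ℝ}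
    (hcoord : ∀ x, b.coord a x = -⟪n, x - x₀⟫_ℝ / c) : ContDiff ℝ ∞ (b.coord a) := by
  have h : (b.coord a : R3 → ℝ) = fun x => -⟪n, x - x₀⟫_ℝ / c := funext hcoord
  rw [h]
  exact (contDiff_const.inner ℝ (contDiff_id.sub contDiff_const)).neg.div_const c

variable [Fintype ι] {n x₀ : ι → R3} {c : ι → ℝ}

theorem contDiff_bubble (hcoord : ∀ a x, b.coord a x = -⟪n a, x - x₀ a⟫_ℝ / c a) (k : ℕ) :
    ContDiff ℝ ∞ (bubble b k) :=
  contDiff_prod fun a _ => contDiff_cutoff.comp (contDiff_const.mul (contDiff_coord b (hcoord a)))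

theorem gradient_bubble [DecidableEq ι]
    (hcoord : ∀ a x, b.coord a x = -⟪n a, x - x₀ a⟫_ℝ / c a) (k : ℕ) (x : R3) :
    gradient (bubble b k) x = ∑ a, layer b a k x • (-(1 / c a) • n a) := by
  refine HasGradientAt.gradient ?_
  rw [hasGradientAt_iff_hasFDerivAt]
  have h1 : ∀ a ∈ Finset.univ, HasFDerivAt (fun x => cutoff (k * b.coord a x))
      ((deriv cutoff (k * b.coord a x)) •
        ((k : ℝ) • InnerProductSpace.toDual ℝ R3 (-(1 / c a) • n a))) x := fun a _ => by
    have h2 : HasFDerivAt (fun x => (k : ℝ) * b.coord a x)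
        ((k : ℝ) • InnerProductSpace.toDual ℝ R3 (-(1 / c a) • n a)) x :=
      ((hasGradientAt_coord b (hcoord a) x).hasFDerivAt).const_mul (k : ℝ)
    exact (((contDiff_cutoff.differentiable (by simp)) _).hasDerivAt).comp_hasFDerivAt x h2
  refine (HasFDerivAt.finsetProd h1).congr_fderiv ?_
  rw [map_sum]
  refine Finset.sum_congr rfl fun a _ => ?_
  rw [map_smulₛₗ _ (layer b a k x), conj_trivial, layer, smul_smul, smul_smul]
  congr 1
  ring

theorem tsupport_bubble_subset {k : ℕ} (hk : 0 < k) :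
    tsupport (bubble b k) ⊆ interior (convexHull ℝ (range b)) := by
  have hk' : (0 : ℝ) < k := by exact_mod_cast hk
  have hcl : IsClosed {x | ∀ a, 1 / (k : ℝ) ≤ b.coord a x} := by
    simp only [ofPred_forall]
    exact isClosed_iInter fun a => isClosed_le continuous_const (continuous_coord b a)
  rw [b.interior_convexHull]
  have hsub : Function.support (bubble b k) ⊆ {x | ∀ a, 1 / (k : ℝ) ≤ b.coord a x} := by
    intro x hx a
    by_contra hlt
    rw [not_le, lt_div_iff₀ hk'] at hlt
    refine hx (Finset.prod_eq_zero (Finset.mem_univ a) (cutoff_eq_zero ?_))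
    rw [mul_comm]
    exact hlt.le
  intro x hx a
  exact lt_of_lt_of_le (by positivity) (closure_minimal hsub hcl hx a)

theorem hasCompactSupport_bubble {k : ℕ} (hk : 0 < k) : HasCompactSupport (bubble b k) :=
  (isCompact_convexHull_range b).of_isClosed_subset (isClosed_tsupport _)
    ((tsupport_bubble_subset b hk).trans interior_subset)

/-- The divergence theorem on a simplex for a function that is continuous up to the boundary and has
an integrable weak gradient; `n a` is the outward unit normal of the facet opposite to the vertex
`b a`, and `c a` is the distance of that vertex from the facet. -/
theorem integral_weakGrad_simplex [DecidableEq ι] (hn : ∀ a, ‖n a‖ = 1)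
    (hc : ∀ a, 0 < c a)
    (hcoord : ∀ a x, b.coord a x = -⟪n a, x - x₀ a⟫_ℝ / c a)
    {f : R3 → ℝ} (hf : ContinuousOn f (convexHull ℝ (range b))) {G : R3 → R3}
    (hG : IsWeakGrad (interior (convexHull ℝ (range b))) f G)
    (hGi : IntegrableOn G (interior (convexHull ℝ (range b)))) :
    ∫ x in interior (convexHull ℝ (range b)), G x
      = ∑ a, (∫ x in {x | x ∈ convexHull ℝ (range b) ∧ b.coord a x = 0}, f x
          ∂(Measure.euclideanHausdorffMeasure 2)) • n a := by
  set K := convexHull ℝ (range b) with hKdef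
  have hK : IsCompact K := isCompact_convexHull_range b
  have hae : (interior K : Set R3) =ᵐ[volume] K :=
    interior_ae_eq_of_null_frontier ((convex_convexHull ℝ _).addHaar_frontier volume)
  have hlayer : ∀ a k, IntegrableOn (fun x => f x * layer b a k x) K := fun a k =>
    (hf.mul (continuous_layer b a k).continuousOn).integrableOn_compact hK
  have hleft : ∀ k, ∫ x in interior K, f x • gradient (bubble b k) x
      = ∑ a, (∫ x in K, f x * layer b a k x) • (-(1 / c a) • n a) := fun k => by
    rw [setIntegral_congr_set hae]
    simp only [gradient_bubble b hcoord, Finset.smul_sum, ← smul_assoc (f _) (layer b _ k _),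
      smul_eq_mul]
    rw [integral_finsetSum _ fun a _ => (hlayer a k).smul_const _]
    exact Finset.sum_congr rfl fun a _ => integral_smul_const _ _
  have hlim1 : Tendsto (fun k => ∫ x in interior K, f x • gradient (bubble b k) x) atTop
      (𝓝 (-∑ a, (∫ x in {x | x ∈ K ∧ b.coord a x = 0}, f x
          ∂(Measure.euclideanHausdorffMeasure 2)) • n a)) := by
    simp only [hleft]
    rw [← Finset.sum_neg_distrib]
    refine tendsto_finsetSum _ fun a _ => ?_
    obtain ⟨e, he⟩ := exists_orthonormalBasis_zero_eq (m := -n a) (by rw [norm_neg, hn])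
    have h1 := (tendsto_integral_layer b a e (x₀ a) (hc a)
      (fun x => by rw [he, inner_neg_left, hcoord]) hf).smul_const (-(1 / c a) • n a)
    rw [← hKdef] at h1
    convert h1 using 2
    rw [smul_smul, ← neg_smul]
    congr 1
    have := (hc a).ne'
    field_simp
  have hlim2 : Tendsto (fun k => ∫ x in interior K, bubble b k x • G x) atTop
      (𝓝 (∫ x in interior K, G x)) := by
    refine tendsto_integral_of_dominated_convergence (fun x => ‖G x‖) (fun k => ?_) hGi.norm
      (fun k => Eventually.of_forall fun x => ?_) ?_
    · exact (contDiff_bubble b hcoord k).continuous.aestronglyMeasurable.smul hGi.1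
    · rw [norm_smul, Real.norm_eq_abs, bubble, abs_of_nonneg (prod_cutoff_nonneg b _ _ _)]
      exact mul_le_of_le_one_left (norm_nonneg _) (prod_cutoff_le_one b _ _ _)
    · refine ae_restrict_of_forall_mem isOpen_interior.measurableSet fun x hx => ?_
      rw [hKdef, b.interior_convexHull] at hx
      refine tendsto_const_nhds.congr' ?_
      filter_upwards [eventually_prod_cutoff_eq_one b Finset.univ
        (tendsto_const_nhds (x := x)) fun j _ => hx j] with k hk
      rw [bubble, hk, one_smul]
  have hlim3 : Tendsto (fun k => ∫ x in interior K, f x • gradient (bubble b k) x) atTop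
      (𝓝 (-∫ x in interior K, G x)) := by
    refine hlim2.neg.congr' ?_
    filter_upwards [eventually_gt_atTop 0] with k hk
    exact (hG.byParts _ (contDiff_bubble b hcoord k) (hasCompactSupport_bubble b hk)
      (tsupport_bubble_subset b hk)).symm
  exact neg_injective (tendsto_nhds_unique hlim3 hlim1)

end Simplex

/-! ### Tetrahedra and their facets -/

/-- `T` is the set of vertices of a nondegenerate tetrahedron. -/
structure IsTet (T : Finset R3) : Prop where
  card_eq : T.card = 4
  indep : AffineIndependent ℝ ((↑) : T → R3)

/-- The vertices of a tetrahedron as an affine basis; its coordinates are the barycentric ones. -/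
noncomputable def IsTet.basis {T : Finset R3} (h : IsTet T) : AffineBasis T ℝ R3 :=
  ⟨(↑), h.indep, by
    rw [h.indep.affineSpan_eq_top_iff_card_eq_finrank_add_one]
    simp [h.card_eq]⟩

/-- `n` is the unit outward normal of the facet `F` of the tetrahedron `T`. -/
def IsOutward (T F : Finset R3) (n : R3) : Prop :=
  ‖n‖ = 1 ∧ (∀ x ∈ F, ∀ y ∈ F, ⟪n, x - y⟫_ℝ = 0) ∧ ∀ x ∈ F, ∀ y ∈ T, y ∉ F → ⟪n, y - x⟫_ℝ < 0

section Tet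

variable {T : Finset R3}

theorem IsTet.range_basis (h : IsTet T) : range h.basis = (T : Set R3) := by
  change range ((↑) : T → R3) = _
  simp

theorem IsTet.hull_eq (h : IsTet T) : hull T = convexHull ℝ (range h.basis) := by
  rw [h.range_basis, hull]

theorem IsTet.mem_hull (h : IsTet T) {x : R3} : x ∈ hull T ↔ ∀ j, 0 ≤ h.basis.coord j x := by
  rw [h.hull_eq, h.basis.convexHull_eq_nonneg_coord]; rfl

/-- An affine function of a convex combination. -/
theorem affineMap_sum_smul (A : R3 →ᵃ[ℝ] ℝ) (s : Finset R3) (w : R3 → ℝ) (hw : ∑ i ∈ s, w i = 1) :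
    A (∑ i ∈ s, w i • i) = ∑ i ∈ s, w i * A i := by
  have hA : ∀ x, A x = A.linear x + A 0 := fun x => by
    have := A.map_vadd 0 x
    simpa using this
  have h1 : ∑ i ∈ s, w i * A i = ∑ i ∈ s, (w i * A.linear i + w i * A 0) :=
    Finset.sum_congr rfl fun i _ => by rw [hA i]; ring
  rw [hA, map_sum, h1, Finset.sum_add_distrib, ← Finset.sum_mul, hw, one_mul]
  simp only [map_smul, smul_eq_mul]

theorem IsTet.coord_self (h : IsTet T) {a : R3} (ha : a ∈ T) : h.basis.coord ⟨a, ha⟩ a = 1 :=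
  h.basis.coord_apply_eq ⟨a, ha⟩

theorem IsTet.coord_of_ne (h : IsTet T) {a j : R3} (ha : a ∈ T) (hj : j ∈ T) (hne : j ≠ a) :
    h.basis.coord ⟨a, ha⟩ j = 0 :=
  h.basis.coord_apply_ne (i := ⟨a, ha⟩) (j := ⟨j, hj⟩) (fun he => hne (Subtype.ext_iff.mp he).symm)

theorem IsTet.sub_eq_sum (h : IsTet T) (x x₀ : R3) :
    x - x₀ = ∑ j, h.basis.coord j x • ((j : R3) - x₀) := by
  have h1 := h.basis.linear_combination_coord_eq_self x
  have h2 := h.basis.sum_coord_apply_eq_one x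
  simp only [smul_sub, Finset.sum_sub_distrib, ← Finset.sum_smul, h2, one_smul]
  conv_lhs => rw [← h1]
  rfl

theorem IsTet.hull_erase [DecidableEq R3] (h : IsTet T) {a : R3} (ha : a ∈ T) :
    hull (T.erase a) = {x | x ∈ hull T ∧ h.basis.coord ⟨a, ha⟩ x = 0} := by
  apply Subset.antisymm
  · intro x hx
    refine ⟨convexHull_mono (Finset.coe_subset.mpr (Finset.erase_subset _ _)) hx, ?_⟩
    have hconv : Convex ℝ (h.basis.coord ⟨a, ha⟩ ⁻¹' {0}) :=
      (convex_singleton 0).affine_preimage _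
    refine convexHull_min (fun j hj => ?_) hconv hx
    rw [Finset.mem_coe, Finset.mem_erase] at hj
    exact h.coord_of_ne ha hj.2 hj.1
  · rintro x ⟨hx, hx0⟩
    have h1 := h.basis.linear_combination_coord_eq_self x
    have h2 := h.basis.sum_coord_apply_eq_one x
    rw [← Finset.add_sum_erase _ _ (Finset.mem_univ ⟨a, ha⟩), hx0] at h1 h2
    rw [zero_smul, zero_add] at h1
    rw [zero_add] at h2
    rw [← h1]
    refine (convex_convexHull ℝ _).sum_mem (fun j _ => h.mem_hull.mp hx j) h2 fun j hj => ?_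
    refine subset_convexHull ℝ _ ?_
    rw [Finset.mem_coe, Finset.mem_erase]
    exact ⟨fun he => Finset.ne_of_mem_erase hj (Subtype.ext he), j.2⟩

/-- For a vector `m` orthogonal to the facet opposite to `a`, the affine function `⟪m, x - x₀⟫` is a
multiple of the barycentric coordinate of `a`. -/
theorem IsTet.inner_sub_eq (h : IsTet T) {a x₀ m : R3} (ha : a ∈ T)
    (hm : ∀ j ∈ T, j ≠ a → ⟪m, j - x₀⟫_ℝ = 0) (x : R3) :
    ⟪m, x - x₀⟫_ℝ = h.basis.coord ⟨a, ha⟩ x * ⟪m, a - x₀⟫_ℝ := by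
  rw [h.sub_eq_sum x x₀, inner_sum, Finset.sum_eq_single ⟨a, ha⟩]
  · rw [inner_smul_right]
  · intro j _ hj
    rw [inner_smul_right, hm j j.2 fun he => hj (Subtype.ext he), mul_zero]
  · simp

theorem IsTet.exists_isOutward [DecidableEq R3] (h : IsTet T) {a : R3} (ha : a ∈ T) :
    ∃ n, IsOutward T (T.erase a) n := by
  -- the normal is the normalized negative gradient of the barycentric coordinate of `a`
  let A := h.basis.coord ⟨a, ha⟩
  let m : R3 := (InnerProductSpace.toDual ℝ R3).symm (LinearMap.toContinuousLinearMap A.linear)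
  have hm : ∀ x y, ⟪m, x - y⟫_ℝ = A x - A y := fun x y => by
    rw [InnerProductSpace.toDual_symm_apply]
    have := A.linearMap_vsub x y
    simpa using this
  have ha1 : A a = 1 := h.coord_self ha
  have hz : ∀ j ∈ T.erase a, A j = 0 := fun j hj =>
    h.coord_of_ne ha (Finset.mem_of_mem_erase hj) (Finset.ne_of_mem_erase hj)
  have hm0 : m ≠ 0 := by
    intro h0
    have hne : (T.erase a).Nonempty := by
      rw [← Finset.card_pos, Finset.card_erase_of_mem ha, h.card_eq]; norm_num
    obtain ⟨j, hj⟩ := hne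
    have := hm a j
    rw [h0, inner_zero_left, ha1, hz j hj] at this
    norm_num at this
  have hpos : 0 < ‖m‖⁻¹ := inv_pos.mpr (norm_pos_iff.mpr hm0)
  refine ⟨-(‖m‖⁻¹ • m), ?_, fun x hx y hy => ?_, fun x hx y hy hyF => ?_⟩
  · rw [norm_neg, norm_smul, norm_inv, norm_norm, inv_mul_cancel₀ (norm_ne_zero_iff.mpr hm0)]
  · rw [inner_neg_left, inner_smul_left, hm, hz x hx, hz y hy]; simp
  · have hya : y = a := by
      by_contra hne
      exact hyF (Finset.mem_erase.mpr ⟨hne, hy⟩)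
    rw [inner_neg_left, inner_smul_left, hm, hya, ha1, hz x hx]
    simpa using hpos

theorem isOutward_outwardNormal {T F : Finset R3} (hex : ∃ n, IsOutward T F n) :
    IsOutward T F (outwardNormal T F) := by
  have hex' : ∃ n : R3, ‖n‖ = 1 ∧ (∀ x ∈ F, ∀ y ∈ F, ⟪n, x - y⟫_ℝ = 0) ∧
      ∀ x ∈ F, ∀ y ∈ T, y ∉ F → ⟪n, y - x⟫_ℝ < 0 := hex
  rw [outwardNormal, dif_pos hex']
  exact hex'.choose_spec

/-- The barycentric coordinate of `a` is the signed distance from the opposite facet, divided by its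
value at `a`. -/
theorem IsOutward.coord_eq [DecidableEq R3] (h : IsTet T) {a x₀ n : R3} (ha : a ∈ T)
    (hn : IsOutward T (T.erase a) n) (hx₀ : x₀ ∈ T.erase a) :
    0 < -⟪n, a - x₀⟫_ℝ ∧ ∀ x, h.basis.coord ⟨a, ha⟩ x = -⟪n, x - x₀⟫_ℝ / -⟪n, a - x₀⟫_ℝ := by
  have hneg := hn.2.2 x₀ hx₀ a ha (Finset.notMem_erase a T)
  refine ⟨by linarith, fun x => ?_⟩
  rw [h.inner_sub_eq ha (fun j hj hja => hn.2.1 j (Finset.mem_erase.mpr ⟨hja, hj⟩) x₀ hx₀) x]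
  have := hneg.ne
  field_simp

/-- A facet of a tetrahedron is opposite to one of its vertices. -/
theorem exists_eq_erase [DecidableEq R3] {T F : Finset R3} (hT : T.card = 4) (hF : F.card = 3)
    (hsub : F ⊆ T) :
    ∃ a ∈ T, F = T.erase a := by
  have h1 : (T \ F).card = 1 := by rw [Finset.card_sdiff_of_subset hsub]; omega
  obtain ⟨a, ha⟩ := Finset.card_eq_one.mp h1
  have haT : a ∈ T \ F := by rw [ha]; exact Finset.mem_singleton_self a
  rw [Finset.mem_sdiff] at haT
  refine ⟨a, haT.1, Finset.eq_of_subset_of_card_le (fun x hx => Finset.mem_erase.mpr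
    ⟨fun he => haT.2 (he ▸ hx), hsub hx⟩) ?_⟩
  rw [Finset.card_erase_of_mem haT.1]
  omega

theorem IsTet.surface_lt_top [DecidableEq R3] (h : IsTet T) {a : R3} (ha : a ∈ T) :
    IsFiniteMeasure (surface (T.erase a)) := by
  obtain ⟨n, hn⟩ := h.exists_isOutward ha
  have hne : (T.erase a).Nonempty := by
    rw [← Finset.card_pos, Finset.card_erase_of_mem ha, h.card_eq]; norm_num
  obtain ⟨x₀, hx₀⟩ := hne
  obtain ⟨hd, hc⟩ := hn.coord_eq h ha hx₀
  obtain ⟨e, he⟩ := exists_orthonormalBasis_zero_eq hn.1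
  refine ⟨?_⟩
  rw [surface, Measure.restrict_apply_univ]
  refine euclideanHausdorffMeasure_lt_top e x₀ (isCompact_hull _) fun x hx => ?_
  rw [h.hull_erase ha] at hx
  have h1 := hx.2
  rw [hc x, div_eq_zero_iff] at h1
  rcases h1 with h1 | h1
  · rw [mem_ofPred_eq, he]; linarith
  · exact absurd h1 hd.ne'

/-- The divergence theorem on a tetrahedron. -/
theorem IsTet.integral_weakGrad [DecidableEq R3] (h : IsTet T) {f : R3 → ℝ}
    (hf : ContinuousOn f (hull T)) {G : R3 → R3} (hG : IsWeakGrad (interior (hull T)) f G)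
    (hGi : IntegrableOn G (interior (hull T))) :
    ∫ x in interior (hull T), G x
      = ∑ a : T, (∫ x, f x ∂(surface (T.erase a))) • outwardNormal T (T.erase a) := by
  have hout : ∀ a : T, IsOutward T (T.erase a) (outwardNormal T (T.erase a)) := fun a =>
    isOutward_outwardNormal (h.exists_isOutward a.2)
  have hne : ∀ a : T, (T.erase (a : R3)).Nonempty := fun a => by
    rw [← Finset.card_pos, Finset.card_erase_of_mem a.2, h.card_eq]; norm_num
  choose x₀ hx₀ using hne
  have hc := fun a : T => (hout a).coord_eq h a.2 (hx₀ a)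
  have hhull : hull T = convexHull ℝ (range h.basis) := h.hull_eq
  have key := integral_weakGrad_simplex h.basis (n := fun a => outwardNormal T (T.erase a))
    (x₀ := x₀) (c := fun a => -⟪outwardNormal T (T.erase a), a - x₀ a⟫_ℝ)
    (fun a => (hout a).1) (fun a => (hc a).1) (fun a => (hc a).2) (hhull ▸ hf) (hhull ▸ hG)
    (hhull ▸ hGi)
  rw [← hhull] at key
  rw [key]
  refine Finset.sum_congr rfl fun a _ => ?_
  rw [surface, h.hull_erase a.2]

end Tet

/-! ### Neighbouring tetrahedra -/

section Neighbours

variable {T T' F : Finset R3}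

/-- The barycentre of a facet, given by its three vertices. -/
noncomputable def bary (F : Finset R3) : R3 := ∑ i ∈ F, (3 : ℝ)⁻¹ • i

theorem bary_mem_hull (hF : F.card = 3) : bary F ∈ hull F := by
  refine (convex_convexHull ℝ _).sum_mem (fun _ _ => by norm_num) ?_
    fun i hi => subset_convexHull ℝ _ hi
  simp [hF]

theorem IsTet.coord_bary_pos [DecidableEq R3] (h : IsTet T) (hF : F.card = 3) (hsub : F ⊆ T)
    {j : R3} (hj : j ∈ F) : 0 < h.basis.coord ⟨j, hsub hj⟩ (bary F) := by
  rw [bary, affineMap_sum_smul _ F (fun _ => (3 : ℝ)⁻¹) (by simp [hF]),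
    Finset.sum_eq_single_of_mem j hj]
  · rw [h.coord_self]; norm_num
  · intro i hi hij
    rw [h.coord_of_ne (hsub hj) (hsub hi) hij, mul_zero]

/-- Near the barycentre of a facet, a tetrahedron coincides with a half-space. -/
theorem IsTet.eventually_mem_hull [DecidableEq R3] (h : IsTet T) (hF : F.card = 3) (hsub : F ⊆ T)
    {n : R3} (hn : IsOutward T F n) :
    ∀ᶠ x in 𝓝 (bary F), ⟪n, x - bary F⟫_ℝ ≤ 0 → x ∈ hull T := by
  obtain ⟨a, ha, rfl⟩ := exists_eq_erase h.card_eq hF hsub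
  obtain ⟨x₀, hx₀⟩ : (T.erase a).Nonempty := by rw [← Finset.card_pos, hF]; norm_num
  obtain ⟨hd, hc⟩ := hn.coord_eq h ha hx₀
  have h0 : h.basis.coord ⟨a, ha⟩ (bary (T.erase a)) = 0 := by
    have := bary_mem_hull hF
    rw [h.hull_erase ha] at this
    exact this.2
  have hj : ∀ j : T, j ≠ ⟨a, ha⟩ → ∀ᶠ x in 𝓝 (bary (T.erase a)), 0 < h.basis.coord j x :=
    fun j hj => by
      have hjF : (j : R3) ∈ T.erase a :=
        Finset.mem_erase.mpr ⟨fun he => hj (Subtype.ext he), j.2⟩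
      exact (isOpen_lt continuous_const (continuous_coord h.basis j)).mem_nhds
        (h.coord_bary_pos hF hsub hjF)
  have hall : ∀ᶠ x in 𝓝 (bary (T.erase a)), ∀ j : T, j ≠ ⟨a, ha⟩ → 0 < h.basis.coord j x := by
    rw [Filter.eventually_all]
    exact fun j => by
      by_cases hja : j = ⟨a, ha⟩
      · simp [hja]
      · filter_upwards [hj j hja] with x hx _ using hx
  filter_upwards [hall] with x hx hle
  refine h.mem_hull.mpr fun j => ?_
  by_cases hja : j = ⟨a, ha⟩
  · subst hja
    have hx0 := hc (bary (T.erase a))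
    rw [h0, eq_comm, div_eq_zero_iff] at hx0
    have h1 : ⟪n, bary (T.erase a) - x₀⟫_ℝ = 0 := by
      rcases hx0 with h1 | h1
      · linarith
      · exact absurd h1 hd.ne'
    rw [hc x, show x - x₀ = (x - bary (T.erase a)) + (bary (T.erase a) - x₀) by abel,
      inner_add_right, h1, add_zero]
    exact div_nonneg (by linarith) hd.le
  · exact (hx j hja).le

theorem IsOutward.inner_eq_zero [DecidableEq R3] (h : IsTet T) (hF : F.card = 3) (hsub : F ⊆ T)
    {n : R3} (hn : IsOutward T F n) {x y : R3} (hx : x ∈ hull F) (hy : y ∈ hull F) :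
    ⟪n, x - y⟫_ℝ = 0 := by
  obtain ⟨a, ha, rfl⟩ := exists_eq_erase h.card_eq hF hsub
  obtain ⟨x₀, hx₀⟩ : (T.erase a).Nonempty := by rw [← Finset.card_pos, hF]; norm_num
  obtain ⟨hd, hc⟩ := hn.coord_eq h ha hx₀
  rw [h.hull_erase ha] at hx hy
  have key : ∀ z, h.basis.coord ⟨a, ha⟩ z = 0 → ⟪n, z - x₀⟫_ℝ = 0 := fun z hz => by
    rw [hc z, div_eq_zero_iff] at hz
    rcases hz with h1 | h1
    · linarith
    · exact absurd h1 hd.ne'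
  rw [show x - y = (x - x₀) - (y - x₀) by abel, inner_sub_right, key x hx.2, key y hy.2, sub_zero]

/-- Two tetrahedra of a face-to-face triangulation lie on different sides of a common facet. -/
theorem IsOutward.eq_neg [DecidableEq R3] (h : IsTet T) (h' : IsTet T') (hF : F.card = 3)
    (hsub : F ⊆ T) (hsub' : F ⊆ T') (hne : T ≠ T')
    (hinter : hull T ∩ hull T' = convexHull ℝ ((T : Set R3) ∩ (T' : Set R3)))
    {n n' : R3} (hn : IsOutward T F n) (hn' : IsOutward T' F n') : n' = -n := by
  have hTT' : T ∩ T' = F := by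
    refine (Finset.eq_of_subset_of_card_le (Finset.subset_inter hsub hsub') ?_).symm
    rw [hF]
    by_contra hlt
    have h1 : T.card ≤ (T ∩ T').card := by rw [h.card_eq]; omega
    have h2 : T'.card ≤ (T ∩ T').card := by rw [h'.card_eq]; omega
    exact hne ((Finset.eq_of_subset_of_card_le Finset.inter_subset_left h1).symm.trans
      (Finset.eq_of_subset_of_card_le Finset.inter_subset_right h2))
  rw [← Finset.coe_inter, hTT'] at hinter
  have hor : n' = n ∨ n' = -n := by
    obtain ⟨a, ha, hFa⟩ := exists_eq_erase h.card_eq hF hsub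
    obtain ⟨x₀, hx₀⟩ : F.Nonempty := by rw [← Finset.card_pos, hF]; norm_num
    rw [hFa] at hn hx₀
    obtain ⟨hd, hc⟩ := hn.coord_eq h ha hx₀
    set d := -⟪n, a - x₀⟫_ℝ with hd_def
    have h1 : ∀ x, ⟪n', x - x₀⟫_ℝ = h.basis.coord ⟨a, ha⟩ x * ⟪n', a - x₀⟫_ℝ := fun x =>
      h.inner_sub_eq ha (fun j hj hja => hn'.2.1 j (hFa ▸ Finset.mem_erase.mpr ⟨hja, hj⟩) x₀
        (hFa ▸ hx₀)) x
    have h2 : n' = (-⟪n', a - x₀⟫_ℝ / d) • n := by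
      refine ext_inner_right ℝ fun v => ?_
      have := h1 (x₀ + v)
      rw [hc (x₀ + v), add_sub_cancel_left] at this
      rw [this, inner_smul_left]
      simp; ring
    have h3 : |-⟪n', a - x₀⟫_ℝ / d| = 1 := by
      have := congrArg norm h2
      rwa [norm_smul, hn.1, hn'.1, mul_one, Real.norm_eq_abs, eq_comm] at this
    rcases (abs_eq one_pos.le).mp h3 with h4 | h4
    · left; rw [h2, h4, one_smul]
    · right; rw [h2, h4, neg_smul, one_smul]
  refine hor.resolve_left fun heq => ?_
  rw [heq] at hn'
  -- points slightly below the barycentre of the facet lie in both tetrahedra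
  have hev := (h.eventually_mem_hull hF hsub hn).and (h'.eventually_mem_hull hF hsub' hn')
  have hlim : Tendsto (fun s : ℝ => bary F - s • n) (𝓝[>] 0) (𝓝 (bary F)) := by
    have hcont : Continuous fun s : ℝ => bary F - s • n := by fun_prop
    have := hcont.tendsto 0
    rw [zero_smul, sub_zero] at this
    exact this.mono_left nhdsWithin_le_nhds
  obtain ⟨s, ⟨hs1, hs2⟩, hs⟩ := ((hlim.eventually hev).and self_mem_nhdsWithin).exists
  have hs : 0 < s := hs
  have hin : ⟪n, bary F - s • n - bary F⟫_ℝ = -s := by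
    rw [show bary F - s • n - bary F = -(s • n) by abel, inner_neg_right, inner_smul_right,
      real_inner_self_eq_norm_sq, hn.1]
    ring
  have hmem : bary F - s • n ∈ hull F := by
    have : bary F - s • n ∈ hull T ∩ hull T' := ⟨hs1 (by linarith), hs2 (by linarith)⟩
    rwa [hinter] at this
  have := hn.inner_eq_zero h hF hsub hmem (bary_mem_hull hF)
  rw [hin] at this
  linarith

theorem bary_mem_interior_union [DecidableEq R3] (h : IsTet T) (h' : IsTet T') (hF : F.card = 3)
    (hsub : F ⊆ T) (hsub' : F ⊆ T') {n : R3} (hn : IsOutward T F n) (hn' : IsOutward T' F (-n)) :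
    bary F ∈ interior (hull T ∪ hull T') := by
  rw [mem_interior_iff_mem_nhds]
  filter_upwards [h.eventually_mem_hull hF hsub hn, h'.eventually_mem_hull hF hsub' hn']
    with x hx hx'
  rcases le_total ⟪n, x - bary F⟫_ℝ 0 with hle | hle
  · exact Or.inl (hx hle)
  · exact Or.inr (hx' (by rw [inner_neg_left]; linarith))

end Neighbours

/-! ### Facets of a triangulation -/

namespace Triangulation

variable {Ω : Set R3} (M : Triangulation Ω)

theorem isTet (T : M.Elem) : IsTet T.1 := ⟨M.card_eq T.1 T.2, M.indep T.1 T.2⟩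

theorem mem_facets {F : Finset R3} : F ∈ M.facets ↔ ∃ T ∈ M.elements, F ⊆ T ∧ F.card = 3 := by
  classical
  simp [facets, Finset.mem_powersetCard]

theorem card_facet (F : M.Facet) : F.1.card = 3 := by
  obtain ⟨T, _, _, h⟩ := M.mem_facets.mp F.2
  exact h

theorem hull_subset (T : M.Elem) : hull T.1 ⊆ closure Ω := by
  rw [← M.cover]
  exact subset_biUnion_of_mem (u := fun T : Finset R3 => hull T) T.2

theorem interior_hull_subset (hΩ : interior (closure Ω) = Ω) (T : M.Elem) :
    interior (hull T.1) ⊆ Ω :=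
  (interior_mono (M.hull_subset T)).trans hΩ.subset

theorem hull_facet_subset {T : M.Elem} {F : M.Facet} (h : F.1 ⊆ T.1) : hull F.1 ⊆ hull T.1 :=
  convexHull_mono (Finset.coe_subset.mpr h)

theorem isOutward (T : M.Elem) (F : M.Facet) (h : F.1 ⊆ T.1) :
    IsOutward T.1 F.1 (outwardNormal T.1 F.1) := by
  classical
  obtain ⟨a, ha, hF⟩ := exists_eq_erase (M.isTet T).card_eq (M.card_facet F) h
  rw [hF]
  exact isOutward_outwardNormal ((M.isTet T).exists_isOutward ha)

theorem outwardNormal_eq_neg {T T' : M.Elem} {F : M.Facet} (h : F.1 ⊆ T.1) (h' : F.1 ⊆ T'.1)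
    (hne : T ≠ T') : outwardNormal T'.1 F.1 = -outwardNormal T.1 F.1 := by
  classical
  exact IsOutward.eq_neg (M.isTet T) (M.isTet T') (M.card_facet F) h h'
    (fun he => hne (Subtype.ext he)) (M.inter _ T.2 _ T'.2) (M.isOutward T F h)
    (M.isOutward T' F h')

instance isFiniteMeasure_surface (F : M.Facet) : IsFiniteMeasure (surface F.1) := by
  classical
  obtain ⟨T, hT, hsub, h3⟩ := M.mem_facets.mp F.2
  have ht := M.isTet ⟨T, hT⟩
  obtain ⟨a, ha, hF⟩ := exists_eq_erase ht.card_eq h3 hsub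
  rw [hF]
  exact ht.surface_lt_top ha

namespace Labelling

variable {M} (o : M.Labelling)

/-- An interior facet belongs to exactly two elements. -/
theorem eq_plus_or_eq_minus {F : M.Facet} (hF : M.IsInterior F) {T : M.Elem} (h : F.1 ⊆ T.1) :
    T = o.plus F ∨ T = o.minus F := by
  by_contra hne
  rw [not_or] at hne
  -- three elements with a common facet would have pairwise opposite normals
  have h1 := M.outwardNormal_eq_neg h (o.subset_plus F) hne.1
  have h2 := M.outwardNormal_eq_neg h (o.subset_minus F hF) hne.2
  have h3 := M.outwardNormal_eq_neg (o.subset_plus F) (o.subset_minus F hF) (o.ne F hF)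
  rw [h1, h2, neg_neg, neg_eq_iff_add_eq_zero, ← two_smul ℝ, smul_eq_zero] at h3
  have h4 := (M.isOutward T F h).1
  rw [h3.resolve_left two_ne_zero, norm_zero] at h4
  exact zero_ne_one h4

/-- A boundary facet belongs to exactly one element. -/
theorem eq_plus (hO : IsOpen Ω) (hΩ : interior (closure Ω) = Ω) {F : M.Facet}
    (hF : M.IsBoundary F) {T : M.Elem} (h : F.1 ⊆ T.1) : T = o.plus F := by
  classical
  by_contra hne
  have hn := M.isOutward T F h
  have hn' := M.isOutward (o.plus F) F (o.subset_plus F)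
  rw [M.outwardNormal_eq_neg h (o.subset_plus F) hne] at hn'
  have h1 := bary_mem_interior_union (M.isTet T) (M.isTet (o.plus F)) (M.card_facet F) h
    (o.subset_plus F) hn hn'
  have h2 : bary F.1 ∈ Ω :=
    hΩ.subset (interior_mono (union_subset (M.hull_subset _) (M.hull_subset _)) h1)
  have h3 := hF (bary_mem_hull (M.card_facet F))
  rw [hO.frontier_eq] at h3
  exact h3.2 h2

theorem outwardNormal_minus {F : M.Facet} (hF : M.IsInterior F) :
    outwardNormal (o.minus F).1 F.1 = -o.normal F :=
  M.outwardNormal_eq_neg (o.subset_plus F) (o.subset_minus F hF) (o.ne F hF)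

open Classical in
/-- Sums over the facets of all elements, arranged by facets. -/
theorem sum_elem_facet (hO : IsOpen Ω) (hΩ : interior (closure Ω) = Ω) (g : M.Elem → M.Facet → ℝ) :
    ∑ T : M.Elem, ∑ F : M.Facet with F.1 ⊆ T.1, g T F
      = (∑ F : M.Facet with M.IsInterior F, (g (o.plus F) F + g (o.minus F) F))
        + ∑ F : M.Facet with M.IsBoundary F, g (o.plus F) F := by
  simp only [Finset.sum_filter]
  rw [Finset.sum_comm, ← Finset.sum_add_distrib]
  refine Finset.sum_congr rfl fun F _ => ?_
  rw [← Finset.sum_filter]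
  by_cases hF : M.IsBoundary F
  · have h1 : (Finset.univ.filter fun T : M.Elem => F.1 ⊆ T.1) = {o.plus F} := by
      ext T
      simp only [Finset.mem_filter, Finset.mem_univ, true_and, Finset.mem_singleton]
      exact ⟨o.eq_plus hO hΩ hF, fun h => h ▸ o.subset_plus F⟩
    have h2 : ¬ M.IsInterior F := not_not.mpr hF
    rw [h1, Finset.sum_singleton, if_neg h2, if_pos hF, zero_add]
  · have h2 : M.IsInterior F := hF
    have h1 : (Finset.univ.filter fun T : M.Elem => F.1 ⊆ T.1) = {o.plus F, o.minus F} := by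
      ext T
      simp only [Finset.mem_filter, Finset.mem_univ, true_and, Finset.mem_insert,
        Finset.mem_singleton]
      exact ⟨o.eq_plus_or_eq_minus h2, fun h => h.elim (fun h => h ▸ o.subset_plus F)
        fun h => h ▸ o.subset_minus F h2⟩
    rw [h1, Finset.sum_pair (o.ne F h2), if_pos h2, if_neg hF, add_zero]

end Labelling

open Classical in
/-- A sum over the facets of an element as a sum over its vertices. -/
theorem sum_facet_eq_sum_vertex (T : M.Elem) (g : Finset R3 → ℝ) :
    ∑ F : M.Facet with F.1 ⊆ T.1, g F.1 = ∑ a : T.1, g (T.1.erase a) := by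
  symm
  have hc : ∀ a : T.1, (T.1.erase a).card = 3 := fun a => by
    rw [Finset.card_erase_of_mem a.2, M.card_eq T.1 T.2]
  refine Finset.sum_bij (fun a _ => (⟨T.1.erase a, M.mem_facets.mpr ⟨T.1, T.2,
    Finset.erase_subset _ _, hc a⟩⟩ : M.Facet)) ?_ ?_ ?_ ?_
  · intro a _
    simp only [Finset.mem_filter, Finset.mem_univ, true_and]
    exact Finset.erase_subset _ _
  · intro a _ a' _ h
    have h1 : T.1.erase (a : R3) = T.1.erase (a' : R3) := Subtype.ext_iff.mp h
    exact Subtype.ext (((Finset.erase_inj T.1 a.2).mp h1))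
  · intro F hF
    simp only [Finset.mem_filter, Finset.mem_univ, true_and] at hF
    obtain ⟨a, ha, hFa⟩ := exists_eq_erase (M.isTet T).card_eq (M.card_facet F) hF
    exact ⟨⟨a, ha⟩, Finset.mem_univ _, Subtype.ext hFa.symm⟩
  · intro a _
    rfl

end Triangulation

/-! ### Bounded functions -/

theorem memLp_top_of_continuousOn {E : Type*} [NormedAddCommGroup E]
    [SecondCountableTopologyEither R3 E] {K : Set R3}
    (hK : IsCompact K) {g : R3 → E} (hg : ContinuousOn g K) (μ : Measure R3) :
    MemLp g ∞ (μ.restrict K) := by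
  obtain ⟨C, hC⟩ := hK.exists_bound_of_continuousOn hg
  exact memLp_top_of_bound (hg.aestronglyMeasurable hK.measurableSet) C
    (ae_restrict_of_forall_mem hK.measurableSet hC)

theorem memLp_top_smul {α E : Type*} [NormedAddCommGroup E] [NormedSpace ℝ E] [MeasurableSpace α]
    {μ : Measure α} {f : α → ℝ} {g : α → E} (hf : MemLp f ∞ μ) (hg : MemLp g ∞ μ) :
    MemLp (fun x => f x • g x) ∞ μ :=
  hg.smul hf

theorem memLp_top_inner {α : Type*} [MeasurableSpace α]
    {μ : Measure α} {f g : α → R3} (hf : MemLp f ∞ μ) (hg : MemLp g ∞ μ) :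
    MemLp (fun x => ⟪f x, g x⟫_ℝ) ∞ μ := by
  have h := (hf.norm.mul hg.norm : MemLp _ ∞ μ)
  refine h.mono (hf.1.inner hg.1) (Eventually.of_forall fun x => ?_)
  refine (norm_inner_le_norm _ _).trans (le_of_eq ?_)
  simp [mul_comm]

theorem integrable_of_memLp_top {α E : Type*} [NormedAddCommGroup E] [MeasurableSpace α]
    {μ : Measure α} [IsFiniteMeasure μ] {f : α → E} (hf : MemLp f ∞ μ) : Integrable f μ :=
  hf.integrable le_top

/-! ### The advection term on an element -/

/-- The Rayleigh quotient is bounded below by the smallest eigenvalue. -/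
theorem lambdaMin_mul_le {A : Matrix (Fin 3) (Fin 3) ℝ} (hA : A.IsHermitian) {ρ : ℝ}
    (hρ : ρ ≤ lambdaMin hA) (v : R3) : ρ * ‖v‖ ^ 2 ≤ v.ofLp ⬝ᵥ A.mulVec v.ofLp := by
  have hmin : ∀ i, ρ ≤ hA.eigenvalues i := fun i =>
    hρ.trans (ciInf_le (finite_range _).bddBelow i)
  have hT : A.transpose = A := by
    have := hA.eq
    rwa [Matrix.conjTranspose_eq_transpose_of_trivial] at this
  let b := hA.eigenvectorBasis
  let w : R3 := WithLp.toLp 2 (A.mulVec v.ofLp)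
  have hin : ∀ x y : R3, ⟪x, y⟫_ℝ = x.ofLp ⬝ᵥ y.ofLp := fun x y => by
    simp [PiLp.inner_apply, dotProduct, mul_comm]
  have hw : ∀ i, ⟪b i, w⟫_ℝ = hA.eigenvalues i * ⟪b i, v⟫_ℝ := fun i => by
    rw [hin, hin]
    change (b i).ofLp ⬝ᵥ A.mulVec v.ofLp = _
    rw [Matrix.dotProduct_mulVec, ← Matrix.mulVec_transpose, hT, hA.mulVec_eigenvectorBasis,
      smul_dotProduct, smul_eq_mul]
  have h1 : v.ofLp ⬝ᵥ A.mulVec v.ofLp = ∑ i, hA.eigenvalues i * ⟪b i, v⟫_ℝ ^ 2 := by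
    have : v.ofLp ⬝ᵥ A.mulVec v.ofLp = ⟪v, w⟫_ℝ := (hin v w).symm
    rw [this, ← b.sum_inner_mul_inner v w]
    refine Finset.sum_congr rfl fun i _ => ?_
    rw [hw, real_inner_comm]; ring
  have h2 : ‖v‖ ^ 2 = ∑ i, ⟪b i, v⟫_ℝ ^ 2 := by
    rw [← real_inner_self_eq_norm_sq, ← b.sum_inner_mul_inner v v]
    refine Finset.sum_congr rfl fun i _ => ?_
    rw [real_inner_comm]; ring
  rw [h1, h2, Finset.mul_sum]
  exact Finset.sum_le_sum fun i _ => mul_le_mul_of_nonneg_right (hmin i) (sq_nonneg _)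

/-- The square of the Euclidean norm of a polynomial field, as a polynomial. -/
noncomputable def normSqPoly (p : PolyField) : MvPolynomial (Fin 3) ℝ :=
  p 0 * p 0 + p 1 * p 1 + p 2 * p 2

theorem evs_normSqPoly (p : PolyField) (x : R3) : evs (normSqPoly p) x = ‖ev p x‖ ^ 2 := by
  rw [EuclideanSpace.norm_sq_eq, Fin.sum_univ_three]
  simp only [normSqPoly, evs_add, evs_mul, ev_apply, Real.norm_eq_abs, sq_abs]
  ring

/-- The weak gradient of `β·p` for a polynomial field `p`, in the form given by the product rule. -/
noncomputable def innerGrad (Ω : Set R3) (β : R3 → R3) (p : PolyField) (x : R3) : R3 :=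
  (evs (p 0) x • weakGrad Ω (fun y => β y 0) x + β x 0 • ev (polyGrad (p 0)) x)
    + (evs (p 1) x • weakGrad Ω (fun y => β y 1) x + β x 1 • ev (polyGrad (p 1)) x)
    + (evs (p 2) x • weakGrad Ω (fun y => β y 2) x + β x 2 • ev (polyGrad (p 2)) x)

/-- The weak gradient of `q β_j` for a polynomial `q`, in the form given by the product rule. -/
noncomputable def mulGrad (Ω : Set R3) (β : R3 → R3) (q : MvPolynomial (Fin 3) ℝ) (j : Fin 3)
    (x : R3) : R3 :=
  evs q x • weakGrad Ω (fun y => β y j) x + β x j • ev (polyGrad q) x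

/-- The pointwise identity behind the coercivity: up to half of the divergence of `|p|² β`, the
quadratic form of the advection-reaction operator is that of the Friedrichs matrix. -/
theorem inner_advection_eq (Ω : Set R3) (β : R3 → R3) (γ : R3 → ℝ) (p : PolyField) (x : R3) :
    ⟪-cross (β x) (ev (curl p) x) + innerGrad Ω β p x + γ x • ev p x, ev p x⟫_ℝ
      = (ev p x).ofLp ⬝ᵥ (friedrichsMatrix Ω β γ x).mulVec (ev p x).ofLp
        + 1 / 2 * ∑ j, mulGrad Ω β (normSqPoly p) j x j := by
  simp only [PiLp.inner_apply, Fin.sum_univ_three, innerGrad, mulGrad, normSqPoly, cross, curl,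
    friedrichsMatrix, Matrix.trace, Matrix.diag, Matrix.mulVec, dotProduct, PiLp.add_apply,
    PiLp.neg_apply, PiLp.smul_apply, ev_apply, polyGrad, Matrix.add_apply, Matrix.smul_apply,
    Matrix.of_apply, Matrix.transpose_apply, Matrix.one_apply, cross_apply, smul_eq_mul,
    RCLike.inner_apply, conj_trivial, Matrix.cons_val, Matrix.cons_val_zero, Matrix.cons_val_one,
    evs_sub, evs_add, evs_mul, map_add, MvPolynomial.pderiv_mul]
  simp
  ring

section Element

variable {Ω : Set R3} (M : Triangulation Ω) (T : M.Elem)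

theorem restrict_hull_eq : (volume.restrict (hull T.1) : Measure R3)
    = volume.restrict (interior (hull T.1)) :=
  (Measure.restrict_congr_set (interior_ae_eq_of_null_frontier
    ((convex_convexHull ℝ _).addHaar_frontier volume))).symm

instance : IsFiniteMeasure (volume.restrict (hull T.1) : Measure R3) :=
  ⟨by simpa using (isCompact_hull T.1).measure_lt_top⟩

variable {M}

theorem restrict_hull_le (hΩ : interior (closure Ω) = Ω) :
    (volume.restrict (hull T.1) : Measure R3) ≤ volume.restrict Ω := by
  rw [restrict_hull_eq]
  exact Measure.restrict_mono (M.interior_hull_subset hΩ T) le_rfl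

variable {β : R3 → R3}

theorem IsVelocity.continuousOn_hull (hβ : IsVelocity Ω β) :
    ContinuousOn β (hull T.1) :=
  hβ.cont.mono (M.hull_subset T)

theorem IsVelocity.continuousOn_hull_apply (hβ : IsVelocity Ω β)
    (j : Fin 3) : ContinuousOn (fun x => β x j) (hull T.1) :=
  (EuclideanSpace.proj j : R3 →L[ℝ] ℝ).continuous.comp_continuousOn (hβ.continuousOn_hull T)

theorem IsVelocity.isWeakGrad (hβ : IsVelocity Ω β)
    (j : Fin 3) :
    IsWeakGrad Ω (fun x => β x j) (weakGrad Ω fun x => β x j) := by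
  obtain ⟨_, G, hG, _⟩ := hβ.sobolev j
  have hex : ∃ G, IsWeakGrad Ω (fun x => β x j) G := ⟨G, hG⟩
  rw [weakGrad, dif_pos hex]
  exact hex.choose_spec

theorem IsVelocity.memLp_weakGrad (hβ : IsVelocity Ω β)
    (hO : IsOpen Ω) (hΩ : interior (closure Ω) = Ω) (j : Fin 3) :
    MemLp (weakGrad Ω fun x => β x j) ∞ (volume.restrict (hull T.1)) := by
  obtain ⟨_, G, hG, hGm⟩ := hβ.sobolev j
  exact ((memLp_congr_ae (hG.weakGrad_ae_eq hO)).mpr hGm).mono_measure (restrict_hull_le T hΩ)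

theorem IsVelocity.isWeakGrad_mulGrad (hβ : IsVelocity Ω β)
    (hO : IsOpen Ω) (hΩ : interior (closure Ω) = Ω)
    (q : MvPolynomial (Fin 3) ℝ) (j : Fin 3) :
    IsWeakGrad (interior (hull T.1)) (fun x => evs q x * β x j) (mulGrad Ω β q j) := by
  have h1 := (hβ.isWeakGrad j).mono hO (M.interior_hull_subset hΩ T)
  have h2 := h1.mul_smooth isOpen_interior
    (((hβ.continuousOn_hull_apply T j).mono interior_subset).locallyIntegrableOn
      isOpen_interior.measurableSet) (contDiff_evs q)
  have h3 : gradient (evs q) = ev (polyGrad q) := funext fun x => (hasGradientAt_evs q x).gradient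
  rw [h3] at h2
  exact h2

theorem IsVelocity.memLp_mulGrad (hβ : IsVelocity Ω β)
    (hO : IsOpen Ω) (hΩ : interior (closure Ω) = Ω)
    (q : MvPolynomial (Fin 3) ℝ) (j : Fin 3) :
    MemLp (mulGrad Ω β q j) ∞ (volume.restrict (hull T.1)) :=
  (memLp_top_smul (memLp_top_of_continuousOn (isCompact_hull _) (continuous_evs q).continuousOn _)
    (hβ.memLp_weakGrad T hO hΩ j)).add
  (memLp_top_smul (memLp_top_of_continuousOn (isCompact_hull _) (hβ.continuousOn_hull_apply T j) _)
    (memLp_top_of_continuousOn (isCompact_hull _) (continuous_ev _).continuousOn _))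

theorem IsVelocity.memLp_innerGrad (hβ : IsVelocity Ω β)
    (hO : IsOpen Ω) (hΩ : interior (closure Ω) = Ω) (p : PolyField) :
    MemLp (innerGrad Ω β p) ∞ (volume.restrict (hull T.1)) :=
  ((hβ.memLp_mulGrad T hO hΩ (p 0) 0).add (hβ.memLp_mulGrad T hO hΩ (p 1) 1)).add
    (hβ.memLp_mulGrad T hO hΩ (p 2) 2)

theorem IsVelocity.isWeakGrad_inner (hβ : IsVelocity Ω β)
    (hO : IsOpen Ω) (hΩ : interior (closure Ω) = Ω) (p : PolyField) :
    IsWeakGrad (interior (hull T.1)) (fun y => ⟪β y, ev p y⟫_ℝ) (innerGrad Ω β p) := by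
  have hl : ∀ j, LocallyIntegrableOn (fun x => evs (p j) x * β x j) (interior (hull T.1)) :=
    fun j => ((continuous_evs _).continuousOn.mul
      ((hβ.continuousOn_hull_apply T j).mono interior_subset)).locallyIntegrableOn
      isOpen_interior.measurableSet
  have h := ((hβ.isWeakGrad_mulGrad T hO hΩ (p 0) 0).add (hβ.isWeakGrad_mulGrad T hO hΩ (p 1) 1)
    (hl 0) (hl 1)).add (hβ.isWeakGrad_mulGrad T hO hΩ (p 2) 2) ((hl 0).add (hl 1)) (hl 2)
  have he : (fun y => ⟪β y, ev p y⟫_ℝ)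
      = fun x => evs (p 0) x * β x 0 + evs (p 1) x * β x 1 + evs (p 2) x * β x 2 := by
    funext x
    simp [PiLp.inner_apply, Fin.sum_univ_three, ev_apply]
  rw [he]
  exact h

theorem IsVelocity.lieAdv_ae_eq (hβ : IsVelocity Ω β)
    (hO : IsOpen Ω) (hΩ : interior (closure Ω) = Ω) (p : PolyField) :
    lieAdv β T.1 p =ᵐ[volume.restrict (hull T.1)]
      fun x => -cross (β x) (ev (curl p) x) + innerGrad Ω β p x := by
  rw [restrict_hull_eq]
  filter_upwards [(hβ.isWeakGrad_inner T hO hΩ p).weakGrad_ae_eq isOpen_interior] with x hx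
  rw [lieAdv, hx]

theorem IsVelocity.memLp_lieAdv (hβ : IsVelocity Ω β)
    (hO : IsOpen Ω) (hΩ : interior (closure Ω) = Ω) (p : PolyField) :
    MemLp (lieAdv β T.1 p) ∞ (volume.restrict (hull T.1)) := by
  rw [memLp_congr_ae (hβ.lieAdv_ae_eq T hO hΩ p)]
  refine MemLp.add (MemLp.neg (memLp_top_of_continuousOn (isCompact_hull _) ?_ _))
    (hβ.memLp_innerGrad T hO hΩ p)
  have h1 := hβ.continuousOn_hull_apply T
  have h2 : ∀ j, ContinuousOn (fun x => ev (curl p) x j) (hull T.1) := fun j =>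
    (continuous_evs _).continuousOn
  refine (PiLp.continuous_toLp 2 _).comp_continuousOn (continuousOn_pi.mpr fun i => ?_)
  fin_cases i <;> simp only [cross_apply, Fin.zero_eta, Fin.mk_one, Fin.reduceFinMk,
    Matrix.cons_val] <;> exact ((h1 _).mul (h2 _)).sub ((h1 _).mul (h2 _))

open Classical in
/-- The divergence theorem for `q β` with a polynomial `q` on an element. -/
theorem IsVelocity.integral_div (hβ : IsVelocity Ω β)
    (hO : IsOpen Ω) (hΩ : interior (closure Ω) = Ω)
    (q : MvPolynomial (Fin 3) ℝ) :
    ∫ x in hull T.1, ∑ j, mulGrad Ω β q j x j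
      = ∑ F : M.Facet with F.1 ⊆ T.1,
          ∫ x, evs q x * ⟪β x, outwardNormal T.1 F.1⟫_ℝ ∂(surface F.1) := by
  have hcont : ∀ j, ContinuousOn (fun x => evs q x * β x j) (hull T.1) := fun j =>
    (continuous_evs q).continuousOn.mul (hβ.continuousOn_hull_apply T j)
  have hint : ∀ j, Integrable (mulGrad Ω β q j) (volume.restrict (hull T.1)) := fun j =>
    integrable_of_memLp_top (hβ.memLp_mulGrad T hO hΩ q j)
  have hj : ∀ j, ∫ x in hull T.1, mulGrad Ω β q j x j
      = ∑ a : T.1, (∫ x, evs q x * β x j ∂(surface (T.1.erase a)))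
          * outwardNormal T.1 (T.1.erase a) j := fun j => by
    have h1 := (M.isTet T).integral_weakGrad (hcont j) (hβ.isWeakGrad_mulGrad T hO hΩ q j)
      (by rw [IntegrableOn, ← restrict_hull_eq]; exact hint j)
    rw [← restrict_hull_eq] at h1
    have h2 := (EuclideanSpace.proj j : R3 →L[ℝ] ℝ).integral_comp_comm (hint j)
    have h3 : ∫ x in hull T.1, mulGrad Ω β q j x j
        = (EuclideanSpace.proj j : R3 →L[ℝ] ℝ) (∫ x in hull T.1, mulGrad Ω β q j x) := h2
    rw [h3, h1, map_sum]
    exact Finset.sum_congr rfl fun a _ => by rw [map_smul]; rfl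
  have hintj : ∀ j, Integrable (fun x => mulGrad Ω β q j x j) (volume.restrict (hull T.1)) :=
    fun j => (EuclideanSpace.proj j : R3 →L[ℝ] ℝ).integrable_comp (hint j)
  rw [integral_finsetSum _ fun j _ => hintj j]
  rw [Finset.sum_congr rfl fun j _ => hj j, Finset.sum_comm,
    M.sum_facet_eq_sum_vertex T fun F => ∫ x, evs q x * ⟪β x, outwardNormal T.1 F⟫_ℝ ∂(surface F)]
  refine Finset.sum_congr rfl fun a _ => ?_
  have := (M.isTet T).surface_lt_top a.2
  have hi : ∀ j, Integrable (fun x => evs q x * β x j) (surface (T.1.erase a)) := fun j =>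
    integrable_of_memLp_top (memLp_top_of_continuousOn (isCompact_hull _) ((hcont j).mono
      (convexHull_mono (Finset.coe_subset.mpr (Finset.erase_subset _ _)))) _)
  simp only [← integral_mul_const]
  rw [← integral_finsetSum _ fun j _ => (hi j).mul_const _]
  refine integral_congr_ae (Eventually.of_forall fun x => ?_)
  simp only [PiLp.inner_apply, Fin.sum_univ_three, RCLike.inner_apply, conj_trivial]
  ring

open Classical in
/-- The advection-reaction term on an element is bounded below by the Friedrichs condition and an
integral over the boundary of the element. -/
theorem IsVelocity.integral_advection_ge (hβ : IsVelocity Ω β)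
    (hO : IsOpen Ω) (hΩ : interior (closure Ω) = Ω)
    {γ : R3 → ℝ} (hγ : MemLp γ ∞ (volume.restrict Ω)) {ρ₀ : ℝ} (hF : Friedrichs Ω β γ ρ₀)
    (p : PolyField) :
    ρ₀ * (∫ x in hull T.1, ‖ev p x‖ ^ 2) + 1 / 2 * ∑ F : M.Facet with F.1 ⊆ T.1,
          ∫ x, ‖ev p x‖ ^ 2 * ⟪β x, outwardNormal T.1 F.1⟫_ℝ ∂(surface F.1)
      ≤ ∫ x in hull T.1, ⟪lieAdv β T.1 p x + γ x • ev p x, ev p x⟫_ℝ := by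
  have hp : MemLp (ev p) ∞ (volume.restrict (hull T.1)) := memLp_ev p (isCompact_hull _) ∞
  have hγT : MemLp γ ∞ (volume.restrict (hull T.1)) := hγ.mono_measure (restrict_hull_le T hΩ)
  have h1 : ∫ x in hull T.1, ∑ j, mulGrad Ω β (normSqPoly p) j x j = ∑ F : M.Facet with F.1 ⊆ T.1,
      ∫ x, ‖ev p x‖ ^ 2 * ⟪β x, outwardNormal T.1 F.1⟫_ℝ ∂(surface F.1) := by
    rw [hβ.integral_div T hO hΩ]
    simp only [evs_normSqPoly]
  have hi1 : Integrable (fun x => ‖ev p x‖ ^ 2) (volume.restrict (hull T.1)) :=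
    ((continuous_ev p).norm.pow 2).continuousOn.integrableOn_compact (isCompact_hull _)
  have hi2 : Integrable (fun x => ∑ j, mulGrad Ω β (normSqPoly p) j x j)
      (volume.restrict (hull T.1)) :=
    integrable_finsetSum _ fun j _ => (EuclideanSpace.proj j : R3 →L[ℝ] ℝ).integrable_comp
      (integrable_of_memLp_top (hβ.memLp_mulGrad T hO hΩ _ j))
  rw [← h1, ← integral_const_mul, ← integral_const_mul, ← integral_add (hi1.const_mul _)
    (hi2.const_mul _)]
  refine integral_mono_ae ((hi1.const_mul _).add (hi2.const_mul _)) (integrable_of_memLp_top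
    (memLp_top_inner ((hβ.memLp_lieAdv T hO hΩ p).add (memLp_top_smul hγT hp)) hp)) ?_
  filter_upwards [hβ.lieAdv_ae_eq T hO hΩ p, ae_mono (restrict_hull_le T hΩ) hF] with x hx hFx
  simp only [hx]
  rw [inner_advection_eq]
  linarith [lambdaMin_mul_le (friedrichsMatrix_isHermitian Ω β γ x) hFx (ev p x)]

end Element

/-! ### The lifting -/

section Lifting

variable {Ω : Set R3} {M : Triangulation Ω} {V : Submodule ℝ (Broken M)} {o : M.Labelling}
  {β : R3 → R3} {αp αm : M.Facet → R3 → ℝ}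

theorem IsVelocity.continuousOn_facet (hβ : IsVelocity Ω β) (o : M.Labelling) (F : M.Facet) :
    ContinuousOn β (hull F.1) :=
  (hβ.continuousOn_hull (o.plus F)).mono (M.hull_facet_subset (o.subset_plus F))

theorem IsVelocity.continuousOn_inner_normal (hβ : IsVelocity Ω β) (o : M.Labelling) (F : M.Facet)
    (n : R3) : ContinuousOn (fun x => ⟪β x, n⟫_ℝ) (hull F.1) :=
  (hβ.continuousOn_facet o F).inner continuousOn_const

theorem continuous_jump (u : Broken M) (F : M.Facet) : Continuous (jump o u F) := by
  unfold jump
  split_ifs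
  · exact (continuous_ev _).sub (continuous_ev _)
  · exact continuous_ev _

theorem memLp_surface {E : Type*} [NormedAddCommGroup E] [SecondCountableTopologyEither R3 E]
    {F : Finset R3} {g : R3 → E} (hg : ContinuousOn g (hull F)) : MemLp g ∞ (surface F) :=
  memLp_top_of_continuousOn (isCompact_hull F) hg _

theorem memLp_weight (hβ : IsVelocity Ω β) (hα : IsFacetWeight M αp αm) (T : M.Elem) (F : M.Facet) :
    MemLp (weight o β αp αm T F) ∞ (surface F.1) := by
  classical
  by_cases hF : M.IsInterior F
  · by_cases hT : T = o.plus F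
    · have : weight o β αp αm T F = αp F := by funext x; simp [weight, hF, hT]
      rw [this]; exact hα.memLp_plus F hF
    · have : weight o β αp αm T F = αm F := by funext x; simp [weight, hF, hT]
      rw [this]; exact hα.memLp_minus F hF
  · have hw : weight o β αp αm T F
        = fun x => (Iio (0 : ℝ)).indicator (fun _ => 1) ⟪β x, o.normal F⟫_ℝ := by
      funext x
      simp [weight, hF, indicator_apply]
    have hm : AEStronglyMeasurable (weight o β αp αm T F) (surface F.1) := by
      rw [hw]
      have h1 : AEMeasurable (fun x => ⟪β x, o.normal F⟫_ℝ) (surface F.1) :=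
        ((hβ.continuousOn_inner_normal o F (o.normal F)).aestronglyMeasurable
          (isCompact_hull F.1).measurableSet).aemeasurable
      exact ((measurable_const.indicator measurableSet_Iio).comp_aemeasurable
        h1).aestronglyMeasurable
    refine memLp_top_of_bound hm 1 (Eventually.of_forall fun x => ?_)
    rw [hw]
    simp only [indicator_apply]
    split_ifs <;> simp

theorem integrable_weight_inner (hβ : IsVelocity Ω β) (hα : IsFacetWeight M αp αm) (T : M.Elem)
    (F : M.Facet) (u : Broken M) (w : PolyField) :
    Integrable (fun x => weight o β αp αm T F x * ⟪⟪β x, o.normal F⟫_ℝ • jump o u F x, ev w x⟫_ℝ)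
      (surface F.1) :=
  integrable_of_memLp_top (memLp_top_smul (memLp_weight hβ hα T F) (memLp_surface
    (((hβ.continuousOn_inner_normal o F _).smul (continuous_jump u F).continuousOn).inner
      (continuous_ev w).continuousOn)))

theorem integrable_inner_ev (T : M.Elem) (p q : PolyField) :
    Integrable (fun x => ⟪ev p x, ev q x⟫_ℝ) (volume.restrict (hull T.1)) :=
  (((continuous_ev p).inner (continuous_ev q)).continuousOn).integrableOn_compact (isCompact_hull _)

theorem interior_hull_nonempty (T : M.Elem) : (interior (hull T.1)).Nonempty := by
  rw [(M.isTet T).hull_eq]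
  exact ⟨_, AffineBasis.centroid_mem_interior_convexHull _⟩

/-- The lifting exists, as the Riesz representative of a linear functional on the local space with
the `L²` inner product. -/
theorem isLifting_lifting {r : ℕ} (hV : IsCurlConforming M V r) (hβ : IsVelocity Ω β)
    (hα : IsFacetWeight M αp αm) (u : Broken M) (T : M.Elem) :
    IsLifting V o β αp αm (fun F y => ⟪β y, o.normal F⟫_ℝ • jump o u F y) T
      (lifting V o β αp αm (fun F y => ⟪β y, o.normal F⟫_ℝ • jump o u F y) T) := by
  classical
  suffices hex : ∃ r, IsLifting V o β αp αm (fun F y => ⟪β y, o.normal F⟫_ℝ • jump o u F y) T r by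
    rw [lifting, dif_pos hex]
    exact hex.choose_spec
  have hle : localSpace V T ≤ polyDeg r := by
    rintro _ ⟨v, hv, rfl⟩
    exact mem_polyDeg.mpr (hV.degree_le v hv T)
  have : FiniteDimensional ℝ (localSpace V T) := Submodule.finiteDimensional_of_le hle
  let B : localSpace V T →ₗ[ℝ] Module.Dual ℝ (localSpace V T) :=
    LinearMap.mk₂ ℝ (fun p q => ∫ x in hull T.1, ⟪ev p.1 x, ev q.1 x⟫_ℝ)
      (fun p p' q => by
        rw [← integral_add (integrable_inner_ev _ _ _) (integrable_inner_ev _ _ _)]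
        exact integral_congr_ae (Eventually.of_forall fun x => by
          simp only [Submodule.coe_add, ev_add, inner_add_left]))
      (fun c p q => by
        rw [smul_eq_mul, ← integral_const_mul]
        exact integral_congr_ae (Eventually.of_forall fun x => by
          simp only [Submodule.coe_smul, ev_smul, inner_smul_left, conj_trivial]))
      (fun p q q' => by
        rw [← integral_add (integrable_inner_ev _ _ _) (integrable_inner_ev _ _ _)]
        exact integral_congr_ae (Eventually.of_forall fun x => by
          simp only [Submodule.coe_add, ev_add, inner_add_right]))
      (fun c p q => by
        rw [smul_eq_mul, ← integral_const_mul]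
        exact integral_congr_ae (Eventually.of_forall fun x => by
          simp only [Submodule.coe_smul, ev_smul, inner_smul_right]))
  have hinj : Function.Injective B := by
    rw [← LinearMap.ker_eq_bot, LinearMap.ker_eq_bot']
    intro p hp
    have h1 : B p p = 0 := by rw [hp]; rfl
    have h2 : ∫ x in hull T.1, ‖ev p.1 x‖ ^ 2 = 0 := by
      rw [← h1]
      exact integral_congr_ae (Eventually.of_forall fun x => (real_inner_self_eq_norm_sq _).symm)
    exact Subtype.ext (eq_zero_of_integral_norm_sq_eq_zero (isCompact_hull _)
      (interior_hull_nonempty T) h2)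
  have hsurj : Function.Surjective B :=
    (LinearMap.injective_iff_surjective_of_finrank_eq_finrank Subspace.dual_finrank_eq.symm).mp hinj
  let ℓ : Module.Dual ℝ (localSpace V T) :=
    { toFun := fun w => ∑ F : M.Facet with F.1 ⊆ T.1, ∫ x, weight o β αp αm T F x *
        ⟪⟪β x, o.normal F⟫_ℝ • jump o u F x, ev w.1 x⟫_ℝ ∂(surface F.1)
      map_add' := fun w w' => by
        rw [← Finset.sum_add_distrib]
        refine Finset.sum_congr rfl fun F _ => ?_
        rw [← integral_add (integrable_weight_inner hβ hα _ _ _ _)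
          (integrable_weight_inner hβ hα _ _ _ _)]
        exact integral_congr_ae (Eventually.of_forall fun x => by
          simp only [Submodule.coe_add, ev_add, inner_add_right, mul_add])
      map_smul' := fun c w => by
        rw [RingHom.id_apply, smul_eq_mul, Finset.mul_sum]
        refine Finset.sum_congr rfl fun F _ => ?_
        rw [← integral_const_mul]
        exact integral_congr_ae (Eventually.of_forall fun x => by
          simp only [Submodule.coe_smul, ev_smul, inner_smul_right, mul_left_comm]) }
  obtain ⟨q, hq⟩ := hsurj ℓ
  exact ⟨q.1, q.2, fun w hw => LinearMap.congr_fun hq ⟨w, hw⟩⟩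

end Lifting

/-! ### Coercivity -/

section Coercivity

variable {Ω : Set R3} {M : Triangulation Ω} {V : Submodule ℝ (Broken M)} {o : M.Labelling}
  {β : R3 → R3} {γ : R3 → ℝ} {αp αm : M.Facet → R3 → ℝ}

/-- The part of the facet `F` of the element `T` in the advection term: half of the flux of
`|u|² β`, minus the contribution to the lifting. -/
noncomputable def facetTerm (o : M.Labelling) (β : R3 → R3) (αp αm : M.Facet → R3 → ℝ)
    (u : Broken M) (T : M.Elem) (F : M.Facet) : ℝ :=
  1 / 2 * (∫ x, ‖ev (u T) x‖ ^ 2 * ⟪β x, outwardNormal T.1 F.1⟫_ℝ ∂(surface F.1))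
    - ∫ x, weight o β αp αm T F x * ⟪⟪β x, o.normal F⟫_ℝ • jump o u F x, ev (u T) x⟫_ℝ
        ∂(surface F.1)

theorem integrable_flux (hβ : IsVelocity Ω β) (o : M.Labelling) (F : M.Facet) (p : PolyField)
    (n : R3) : Integrable (fun x => ‖ev p x‖ ^ 2 * ⟪β x, n⟫_ℝ) (surface F.1) :=
  integrable_of_memLp_top (memLp_surface
    (((continuous_ev p).norm.pow 2).continuousOn.mul (hβ.continuousOn_inner_normal o F n)))

/-- The two contributions of an interior facet combine to the upwind penalty of the jump. -/
theorem facetTerm_interior (hβ : IsVelocity Ω β) (hα : IsFacetWeight M αp αm) {C : ℝ} (hC : 0 < C)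
    (hup : Upwind o β αp αm C) (u : Broken M) {F : M.Facet} (hF : M.IsInterior F) :
    facetTerm o β αp αm u (o.plus F) F + facetTerm o β αp αm u (o.minus F) F
      = 1 / 2 * ∫ x, |(αp F x - αm F x) * ⟪β x, o.normal F⟫_ℝ| * ‖jump o u F x‖ ^ 2
          ∂(surface F.1) := by
  have i1 := integrable_flux hβ o F (u (o.plus F)) (outwardNormal (o.plus F).1 F.1)
  have i2 := integrable_flux hβ o F (u (o.minus F)) (outwardNormal (o.minus F).1 F.1)
  have j1 := integrable_weight_inner (o := o) hβ hα (o.plus F) F u (u (o.plus F))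
  have j2 := integrable_weight_inner (o := o) hβ hα (o.minus F) F u (u (o.minus F))
  rw [facetTerm, facetTerm, ← integral_const_mul, ← integral_const_mul, ← integral_const_mul,
    ← integral_sub (i1.const_mul _) j1, ← integral_sub (i2.const_mul _) j2]
  refine (integral_add ((i1.const_mul _).sub j1) ((i2.const_mul _).sub j2)).symm.trans ?_
  refine setIntegral_congr_fun (isCompact_hull F.1).measurableSet fun x hx => ?_
  have hw1 : weight o β αp αm (o.plus F) F x = αp F x := by simp [weight, hF]
  have hw2 : weight o β αp αm (o.minus F) F x = αm F x := by
    simp [weight, hF, (o.ne F hF).symm]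
  have hj : jump o u F x = ev (u (o.plus F)) x - ev (u (o.minus F)) x := by simp [jump, hF]
  have hsum := hα.add_eq_one F hF x hx
  have hupx := hup F hF x hx
  have hsign : (αp F x - αm F x) * ⟪β x, o.normal F⟫_ℝ ≤ 0 := by
    have := mul_nonneg hC.le (abs_nonneg ⟪β x, o.normal F⟫_ℝ)
    nlinarith
  have hplus : outwardNormal (o.plus F).1 F.1 = o.normal F := rfl
  simp only [Pi.sub_apply, hw1, hw2, hj, abs_of_nonpos hsign, hplus, o.outwardNormal_minus hF,
    inner_neg_right, inner_smul_left, conj_trivial, inner_sub_left,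
    norm_sub_sq_real, real_inner_self_eq_norm_sq,
    real_inner_comm (ev (u (o.plus F)) x) (ev (u (o.minus F)) x)]
  have hm : αm F x = 1 - αp F x := by linarith
  rw [hm]
  ring

/-- On a boundary facet the upwind weight turns the flux into its absolute value. -/
theorem facetTerm_boundary (hβ : IsVelocity Ω β) (hα : IsFacetWeight M αp αm) (u : Broken M)
    {F : M.Facet} (hF : M.IsBoundary F) :
    facetTerm o β αp αm u (o.plus F) F
      = 1 / 2 * ∫ x, |⟪β x, o.normal F⟫_ℝ| * ‖jump o u F x‖ ^ 2 ∂(surface F.1) := by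
  have i1 := integrable_flux hβ o F (u (o.plus F)) (outwardNormal (o.plus F).1 F.1)
  have j1 := integrable_weight_inner (o := o) hβ hα (o.plus F) F u (u (o.plus F))
  rw [facetTerm, ← integral_const_mul, ← integral_const_mul, ← integral_sub (i1.const_mul _) j1]
  refine integral_congr_ae (Eventually.of_forall fun x => ?_)
  have hF' : ¬ M.IsInterior F := not_not.mpr hF
  have hj : jump o u F x = ev (u (o.plus F)) x := by simp [jump, hF']
  have hplus : outwardNormal (o.plus F).1 F.1 = o.normal F := rfl
  simp only [hj, hplus, inner_smul_left, conj_trivial, real_inner_self_eq_norm_sq, weight, hF',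
    if_false]
  split_ifs with hneg
  · rw [abs_of_neg hneg]; ring
  · rw [abs_of_nonneg (not_lt.mp hneg)]; ring

theorem l2norm_sq (T : Finset R3) (w : R3 → R3) : l2norm T w ^ 2 = ∫ x in hull T, ‖w x‖ ^ 2 :=
  Real.sq_sqrt (integral_nonneg fun x => by positivity)

theorem memLp_discAdv (hβ : IsVelocity Ω β) (hO : IsOpen Ω) (hΩ : interior (closure Ω) = Ω)
    (u : Broken M) (T : M.Elem) :
    MemLp (discAdv V o β αp αm u T) ∞ (volume.restrict (hull T.1)) :=
  (hβ.memLp_lieAdv T hO hΩ (u T)).sub (memLp_ev _ (isCompact_hull _) ∞)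

open Classical in
/-- The advection-reaction term of the bilinear form on an element. -/
theorem integral_discAdv_ge {r : ℕ} (hV : IsCurlConforming M V r) (hβ : IsVelocity Ω β)
    (hO : IsOpen Ω) (hΩ : interior (closure Ω) = Ω) (hα : IsFacetWeight M αp αm)
    (hγ : MemLp γ ∞ (volume.restrict Ω)) {ρ₀ : ℝ} (hF : Friedrichs Ω β γ ρ₀)
    {u : Broken M} (hu : u ∈ V) (T : M.Elem) :
    ρ₀ * l2norm T.1 (ev (u T)) ^ 2 + ∑ F : M.Facet with F.1 ⊆ T.1, facetTerm o β αp αm u T F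
      ≤ ∫ x in hull T.1, ⟪discAdv V o β αp αm u T x + γ x • ev (u T) x, ev (u T) x⟫_ℝ := by
  have hp : MemLp (ev (u T)) ∞ (volume.restrict (hull T.1)) := memLp_ev _ (isCompact_hull _) ∞
  have hγT : MemLp γ ∞ (volume.restrict (hull T.1)) := hγ.mono_measure (restrict_hull_le T hΩ)
  have h1 := hβ.integral_advection_ge T hO hΩ hγ hF (u T)
  have h2 := (isLifting_lifting (o := o) hV hβ hα u T).2 (u T) ⟨u, hu, rfl⟩
  set R := lifting V o β αp αm (fun F y => ⟪β y, o.normal F⟫_ℝ • jump o u F y) T with hR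
  have h3 : ∫ x in hull T.1, ⟪discAdv V o β αp αm u T x + γ x • ev (u T) x, ev (u T) x⟫_ℝ
      = (∫ x in hull T.1, ⟪lieAdv β T.1 (u T) x + γ x • ev (u T) x, ev (u T) x⟫_ℝ)
        - ∫ x in hull T.1, ⟪ev R x, ev (u T) x⟫_ℝ := by
    have hi : Integrable (fun x => ⟪lieAdv β T.1 (u T) x + γ x • ev (u T) x, ev (u T) x⟫_ℝ)
        (volume.restrict (hull T.1)) := integrable_of_memLp_top (memLp_top_inner
      ((hβ.memLp_lieAdv T hO hΩ (u T)).add (memLp_top_smul hγT hp)) hp)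
    rw [← integral_sub hi (integrable_inner_ev T R (u T))]
    refine integral_congr_ae (Eventually.of_forall fun x => ?_)
    simp only [discAdv, ← hR, ← inner_sub_left]
    congr 1
    abel
  rw [h3, h2, l2norm_sq]
  simp only [facetTerm, Finset.sum_sub_distrib, ← Finset.mul_sum]
  linarith

/-- The stabilization term on an element, bounded below by Young's inequality. -/
theorem integral_modOp_ge (hβ : IsVelocity Ω β)
    (hO : IsOpen Ω) (hΩ : interior (closure Ω) = Ω) (hγ : MemLp γ ∞ (volume.restrict Ω))
    (u : Broken M) (T : M.Elem) (ε : ℝ) {δ : ℝ} (hδ : 0 ≤ δ) :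
    δ * (1 / 2 * l2norm T.1 (discAdv V o β αp αm u T) ^ 2
        - ε ^ 2 * l2norm T.1 (ev (curl (curl (u T)))) ^ 2
        - linftyNorm T.1 γ ^ 2 * l2norm T.1 (ev (u T)) ^ 2)
      ≤ ∫ x in hull T.1, ⟪modOp V o ε β γ αp αm u T x, δ • discAdv V o β αp αm u T x⟫_ℝ := by
  have hp : ∀ p, MemLp (ev p) ∞ (volume.restrict (hull T.1)) := fun p =>
    memLp_ev p (isCompact_hull _) ∞
  have hγT : MemLp γ ∞ (volume.restrict (hull T.1)) := hγ.mono_measure (restrict_hull_le T hΩ)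
  have hL := memLp_discAdv (V := V) (o := o) (αp := αp) (αm := αm) hβ hO hΩ u T
  set L := discAdv V o β αp αm u T with hLdef
  have hsq : ∀ {g : R3 → R3}, MemLp g ∞ (volume.restrict (hull T.1)) →
      Integrable (fun x => ‖g x‖ ^ 2) (volume.restrict (hull T.1)) := fun {g} hg => by
    have := integrable_of_memLp_top (memLp_top_inner hg hg)
    simpa only [real_inner_self_eq_norm_sq] using this
  have hγb : ∀ᵐ x ∂(volume.restrict (hull T.1)), |γ x| ≤ linftyNorm T.1 γ := by
    filter_upwards [ae_le_eLpNormEssSup (f := γ) (μ := volume.restrict (hull T.1))] with x hx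
    rw [← eLpNorm_exponent_top] at hx
    have := ENNReal.toReal_mono hγT.2.ne hx
    rwa [toReal_enorm, Real.norm_eq_abs] at this
  have i1 := hsq hL
  have i2 := hsq (hp (curl (curl (u T))))
  have i3 := hsq (hp (u T))
  have i12 : Integrable (fun x => 1 / 2 * ‖L x‖ ^ 2 - ε ^ 2 * ‖ev (curl (curl (u T))) x‖ ^ 2)
      (volume.restrict (hull T.1)) := (i1.const_mul _).sub (i2.const_mul _)
  simp only [l2norm_sq]
  rw [← integral_const_mul, ← integral_const_mul, ← integral_const_mul,
    ← integral_sub (i1.const_mul _) (i2.const_mul _), ← integral_sub i12 (i3.const_mul _),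
    ← integral_const_mul]
  have hmod : MemLp (modOp V o ε β γ αp αm u T) ∞ (volume.restrict (hull T.1)) :=
    (((hp (curl (curl (u T)))).const_smul ε).add hL).add (memLp_top_smul hγT (hp (u T)))
  refine integral_mono_ae ((i12.sub (i3.const_mul _)).const_mul _)
    (integrable_of_memLp_top (memLp_top_inner hmod (hL.const_smul δ))) ?_
  filter_upwards [hγb] with x hx
  simp only [modOp, ← hLdef, inner_smul_right]
  refine mul_le_mul_of_nonneg_left ?_ hδ
  rw [inner_add_left, inner_add_left, inner_smul_left, inner_smul_left, real_inner_self_eq_norm_sq]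
  simp only [conj_trivial]
  -- Young's inequality `⟪a, L⟫ ≥ -‖a‖² - ‖L‖² / 4` for the second-order and the reaction term
  have y1 := norm_add_sq_real (ε • ev (curl (curl (u T))) x) ((1 / 2 : ℝ) • L x)
  have y2 := norm_add_sq_real (γ x • ev (u T) x) ((1 / 2 : ℝ) • L x)
  have n1 := sq_nonneg ‖ε • ev (curl (curl (u T))) x + (1 / 2 : ℝ) • L x‖
  have n2 := sq_nonneg ‖γ x • ev (u T) x + (1 / 2 : ℝ) • L x‖
  rw [y1] at n1
  rw [y2] at n2
  simp only [norm_smul, mul_pow, inner_smul_left, inner_smul_right, Real.norm_eq_abs, sq_abs,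
    conj_trivial] at n1 n2
  have hγ2 : γ x ^ 2 * ‖ev (u T) x‖ ^ 2 ≤ linftyNorm T.1 γ ^ 2 * ‖ev (u T) x‖ ^ 2 :=
    mul_le_mul_of_nonneg_right (sq_le_sq' (abs_le.mp hx).1 (abs_le.mp hx).2) (sq_nonneg _)
  nlinarith

/-- The bound on the stabilization parameter absorbs the second-order term. -/
theorem delta_mul_curl_curl_le {ε C h δ c cc : ℝ} (hε : 0 < ε) (hC : 0 < C) (hδ0 : 0 ≤ δ)
    (hδ : δ ≤ h ^ 2 / (2 * C ^ 2 * ε)) (hcc0 : 0 ≤ cc) (hcc : cc ≤ C * h⁻¹ * c) :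
    δ * (ε ^ 2 * cc ^ 2) ≤ ε / 2 * c ^ 2 := by
  have h1 : cc ^ 2 ≤ (C * h⁻¹ * c) ^ 2 := pow_le_pow_left₀ hcc0 hcc 2
  calc δ * (ε ^ 2 * cc ^ 2) ≤ δ * (ε ^ 2 * (C * h⁻¹ * c) ^ 2) := by gcongr
    _ ≤ h ^ 2 / (2 * C ^ 2 * ε) * (ε ^ 2 * (C * h⁻¹ * c) ^ 2) := by gcongr
    _ ≤ ε / 2 * c ^ 2 := by
        -- for `h = 0` the left-hand side is zero, by the convention for `h⁻¹`
        rcases eq_or_ne h 0 with rfl | hh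
        · simp; positivity
        · refine le_of_eq ?_
          field_simp

/-- Discrete coercivity. The stabilization takes away at most half of each volume term; the facet
terms are not touched by it. -/
theorem energySq_le_supgForm (hO : IsOpen Ω) (hΩ : interior (closure Ω) = Ω) {r : ℕ}
    (hV : IsCurlConforming M V r) {ε : ℝ} (hε : 0 < ε) (hβ : IsVelocity Ω β)
    (hγ : MemLp γ ∞ (volume.restrict Ω)) {ρ₀ : ℝ} (hF : Friedrichs Ω β γ ρ₀)
    (hα : IsFacetWeight M αp αm) {Cup : ℝ} (hCup : 0 < Cup) (hup : Upwind o β αp αm Cup)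
    {Cinv : ℝ} (hCinv : 0 < Cinv) (hinv : InverseCurl M V Cinv) {δ : M.Elem → ℝ}
    (hδ0 : ∀ T, 0 ≤ δ T) (hδ : ∀ T, δ T ≤ M.diam T ^ 2 / (2 * Cinv ^ 2 * ε))
    (hδγ : ∀ T, 2 * linftyNorm T.1 γ ^ 2 * δ T ≤ ρ₀) {v : Broken M} (hv : v ∈ V) :
    1 / 2 * energySq V o ε ρ₀ β αp αm δ v ≤ supgForm V o ε β γ αp αm δ v v := by
  classical
  have hcurl : ∑ T : M.Elem, ∫ x in hull T.1, ⟪ε • ev (curl (v T)) x, ev (curl (v T)) x⟫_ℝ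
      = ε * ∑ T : M.Elem, l2norm T.1 (ev (curl (v T))) ^ 2 := by
    rw [Finset.mul_sum]
    refine Finset.sum_congr rfl fun T _ => ?_
    rw [l2norm_sq, ← integral_const_mul]
    refine integral_congr_ae (Eventually.of_forall fun x => ?_)
    simp only [inner_smul_left, conj_trivial, real_inner_self_eq_norm_sq]
  have hadv := Finset.sum_le_sum fun T (_ : T ∈ Finset.univ) =>
    integral_discAdv_ge (o := o) hV hβ hO hΩ hα hγ hF hv T
  rw [Finset.sum_add_distrib, ← Finset.mul_sum, o.sum_elem_facet hO hΩ] at hadv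
  have hint : ∑ F : M.Facet with M.IsInterior F,
      (facetTerm o β αp αm v (o.plus F) F + facetTerm o β αp αm v (o.minus F) F)
      = 1 / 2 * ∑ F : M.Facet with M.IsInterior F,
        ∫ x, |(αp F x - αm F x) * ⟪β x, o.normal F⟫_ℝ| * ‖jump o v F x‖ ^ 2 ∂(surface F.1) := by
    rw [Finset.mul_sum]
    exact Finset.sum_congr rfl fun F hF =>
      facetTerm_interior hβ hα hCup hup v (Finset.mem_filter.mp hF).2
  have hbd : ∑ F : M.Facet with M.IsBoundary F, facetTerm o β αp αm v (o.plus F) F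
      = 1 / 2 * ∑ F : M.Facet with M.IsBoundary F,
        ∫ x, |⟪β x, o.normal F⟫_ℝ| * ‖jump o v F x‖ ^ 2 ∂(surface F.1) := by
    rw [Finset.mul_sum]
    exact Finset.sum_congr rfl fun F hF => facetTerm_boundary hβ hα v (Finset.mem_filter.mp hF).2
  rw [hint, hbd] at hadv
  have hstab : ∑ T : M.Elem, (1 / 2 * (δ T * l2norm T.1 (discAdv V o β αp αm v T) ^ 2)
        - ε / 2 * l2norm T.1 (ev (curl (v T))) ^ 2 - ρ₀ / 2 * l2norm T.1 (ev (v T)) ^ 2)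
      ≤ ∑ T : M.Elem, ∫ x in hull T.1,
        ⟪modOp V o ε β γ αp αm v T x, δ T • discAdv V o β αp αm v T x⟫_ℝ := by
    refine Finset.sum_le_sum fun T _ => ?_
    have h1 := integral_modOp_ge (V := V) (o := o) (αp := αp) (αm := αm) hβ hO hΩ hγ v T ε (hδ0 T)
    have h2 := delta_mul_curl_curl_le hε hCinv (hδ0 T) (hδ T) (Real.sqrt_nonneg _) (hinv v hv T)
    have h2' : δ T * (ε ^ 2 * l2norm T.1 (ev (curl (curl (v T)))) ^ 2)
        ≤ ε / 2 * l2norm T.1 (ev (curl (v T))) ^ 2 := h2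
    have h3 := mul_le_mul_of_nonneg_right (hδγ T) (sq_nonneg (l2norm T.1 (ev (v T))))
    nlinarith
  simp only [Finset.sum_sub_distrib, ← Finset.mul_sum] at hstab
  have hJ1 : 0 ≤ ∑ F : M.Facet with M.IsInterior F,
      ∫ x, |(αp F x - αm F x) * ⟪β x, o.normal F⟫_ℝ| * ‖jump o v F x‖ ^ 2 ∂(surface F.1) :=
    Finset.sum_nonneg fun F _ => integral_nonneg fun x => by positivity
  have hJ2 : 0 ≤ ∑ F : M.Facet with M.IsBoundary F,
      ∫ x, |⟪β x, o.normal F⟫_ℝ| * ‖jump o v F x‖ ^ 2 ∂(surface F.1) :=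
    Finset.sum_nonneg fun F _ => integral_nonneg fun x => by positivity
  rw [energySq, supgForm, hcurl]
  linarith

end Coercivity

end SUPG

theorem lemma4p2 :
    -- the inverse inequality for the curl: constants depend on shape regularity and degree only
    (∀ (σ : ℝ) (r : ℕ), ∃ C : ℝ, 0 < C ∧
      ∀ (Ω : Set R3) (M : Triangulation Ω) (V : Submodule ℝ (Broken M)),
        M.ShapeRegular σ → IsCurlConforming M V r → InverseCurl M V C) ∧
    -- coercivity, for every such constant
    (∀ (Ω : Set R3), IsOpen Ω → interior (closure Ω) = Ω →
      ∀ (M : Triangulation Ω) (o : M.Labelling) (r : ℕ) (V : Submodule ℝ (Broken M)),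
      IsCurlConforming M V r →
      ∀ (ε : ℝ), 0 < ε →
      ∀ (β : R3 → R3), IsVelocity Ω β →
      ∀ (γ : R3 → ℝ), MemLp γ ∞ (volume.restrict Ω) →
      ∀ (ρ₀ : ℝ), 0 < ρ₀ → Friedrichs Ω β γ ρ₀ →
      ∀ (αp αm : M.Facet → R3 → ℝ), IsFacetWeight M αp αm →
      ∀ (Cup : ℝ), 0 < Cup → Upwind o β αp αm Cup →
      ∀ (Cinv : ℝ), 0 < Cinv → InverseCurl M V Cinv →
      ∀ (δ : M.Elem → ℝ), (∀ T, 0 ≤ δ T) →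
        (∀ T, δ T ≤ M.diam T ^ 2 / (2 * Cinv ^ 2 * ε)) →
        -- `δ_T ≤ ρ₀ / (2 ‖γ‖²)`, which is no restriction where `γ = 0`
        (∀ T, 2 * linftyNorm T.1 γ ^ 2 * δ T ≤ ρ₀) →
      ∀ v ∈ V, supgForm V o ε β γ αp αm δ v v ≥ 1 / 2 * energySq V o ε ρ₀ β αp αm δ v) := by
  refine ⟨exists_inverseCurl, ?_⟩
  intro Ω hO hΩ M o r V hV ε hε β hβ γ hγ ρ₀ _ hF αp αm hα Cup hCup hup Cinv hCinv hinv δ hδ0 hδ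
    hδγ v hv
  exact energySq_le_supgForm hO hΩ hV hε hβ hγ hF hα hCup hup hCinv hinv hδ0 hδ hδγ hv
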